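/- **Theorem (law of large numbers).** Let $\sigma>0$, $H\in(\tfrac12,1)$, $s_0>0$, and let $(\xi_i)_{i\ge1}$ be i.i.d. random variables on a probability space $(\Omega,\mathcal F,P)$ with $P(\xi_1=1)=P(\xi_1=-1)=\tfrac12$. Let $$c_H=\sqrt{\frac{2H\,\Gamma(\frac32-H)}{\Gamma(H+\frac12)\,\Gamma(2-2H)}},\qquad C_H=(H-\tfrac12)\,c_H,\qquad g=\frac{\sigma c_H}{H+\frac12},$$ and, for $n\ge1$ and $1\le i\le n-1$, $$j_n(i)=\sigma C_H\int_{i-1}^{i}x^{\frac12-H}\Big(\int_0^1(v+n-1)^{H-\frac12}(v+n-1-x)^{H-\frac32}\,dv\Big)dx,$$ $$g_n=\sigma C_H\int_{n-1}^{n}x^{\frac12-H}(n-x)^{H-\frac12}\Big(\int_0^1(y(n-x)+x)^{H-\frac12}y^{H-\frac32}\,dy\Big)dx .$$ Put $\mathcal Y_n=\sum_{i=1}^{n-1}j_n(i)\xi_i$ and $X_n=\mathcal Y_n+g_n\xi_n$ for $n\ge1$, with the conventions $\mathcal Y_0=0$ and $g_0\xi_0=0$ (so $X_0=0$). For $n\ge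 1$ let $\rho(n)=\frac12\big[(n+1)^{2h}+(n-1)^{2h}-2n^{2h}\big]$ with $h=\frac H2+\frac14$. For $N\ge1$ consider the market with bond price $1$ and stock price $S^N_0=s_0$, $S^N_n=(1+X_nN^{-H})S^N_{n-1}$ for $1\le n\le N$. Let $V_n(\phi^N)$ be the value at time $n$ of the self-financing strategy without transaction costs and without initial holdings whose stock position is $\phi^{1,N}_0=0$, $\phi^{1,N}_k=N^{H-1}X_k/S^N_k$ for $1\le k\le N$ (with $x/0:=0$). Define $$\mathcal S^{(1)}_n=\sum_{k=1}^n g_{k-1}g_k\xi_{k-1}\xi_k,\quad \mathcal S^{(2)}_n=\sum_{k=1}^n g_k\xi_k\mathcal Y_{k-1},\quad \mathcal S^{(3)}_n=\sum_{k=1}^n g_{k-1}\xi_{k-1}\mathcal Y_k,\quad \mathcal S^{(4)}_n=\sum_{k=1}^n\mathcal Y_{k-1}\mathcal Y_k .$$ For all sufficiently large $N$, almost surely $S^N_n\neq0$ for all $n\le N$; and for every $N\ge1$, wherever $S^N_n\ne0$ for all $n\le N$, one has for all $n\le N$ $$V_n(\phi^N)=\frac1N\sum_{k=1}^nX_{k-1}X_k=\frac1N\big(\mathcal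 S^{(1)}_n+\mathcal S^{(2)}_n+\mathcal S^{(3)}_n+\mathcal S^{(4)}_n\big).$$ Moreover, as $N\to\infty$: 1. $\frac1N\mathcal S^{(1)}_N\to0$ almost surely; 2. $\frac1N\mathcal S^{(2)}_N\to0$ in $L^2(P)$; 3. $\frac1N\mathcal S^{(3)}_N\to g^2\big(2^{H+\frac12}-2\big)>0$ in $L^2(P)$; 4. the series $\sum_{k\ge2}\rho(k)\rho(k-1)$ converges and $\frac1N\mathcal S^{(4)}_N\to4g^2\sum_{k=2}^\infty\rho(k)\rho(k-1)>0$ in $L^1(P)$. In particular, $V_N(\phi^N)\to\vartheta$ in probability, where $\vartheta=4g^2\sum_{k=2}^\infty\rho(k)\rho(k-1)+g^2\big(2^{H+\frac12}-2\big)>0$. -/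

import Mathlib

open MeasureTheory ProbabilityTheory Filter Topology

noncomputable section

namespace FracBinary

/-- The normalising constant `c_H` of the kernel representation of fractional Brownian motion
of Hurst parameter `H ∈ (1/2, 1)`. -/
def cH (H : ℝ) : ℝ :=
  Real.sqrt (2 * H * Real.Gamma (3 / 2 - H) / (Real.Gamma (H + 1 / 2) * Real.Gamma (2 - 2 * H)))

/-- `C_H = (H - 1/2) c_H`. -/
def CH (H : ℝ) : ℝ := (H - 1 / 2) * cH H

/-- The coefficients `j_n(i)`, for `1 ≤ i ≤ n - 1`. -/
def jcoef (σ H : ℝ) (n i : ℕ) : ℝ :=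
  σ * CH H * ∫ x in ((i : ℝ) - 1)..(i : ℝ), x ^ (1 / 2 - H) *
    ∫ v in (0 : ℝ)..1, (v + n - 1) ^ (H - 1 / 2) * (v + n - 1 - x) ^ (H - 3 / 2)

/-- The coefficients `g_n`, for `n ≥ 1`; by convention `g_0 = 0`, so that `X_0 = 0`. -/
def gcoef (σ H : ℝ) (n : ℕ) : ℝ :=
  if n = 0 then 0 else
    σ * CH H * ∫ x in ((n : ℝ) - 1)..(n : ℝ), x ^ (1 / 2 - H) * ((n : ℝ) - x) ^ (H - 1 / 2) *
      ∫ y in (0 : ℝ)..1, (y * ((n : ℝ) - x) + x) ^ (H - 1 / 2) * y ^ (H - 3 / 2)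

/-- The constant `g = σ c_H / (H + 1/2)`. -/
def gconst (σ H : ℝ) : ℝ := σ * cH H / (H + 1 / 2)

/-- The autocovariance function `ρ(n)`, `n ≥ 1`, of the increments of a fractional Brownian motion
of Hurst parameter `h = H / 2 + 1 / 4`. -/
def rho (H : ℝ) (n : ℕ) : ℝ :=
  1 / 2 * (((n : ℝ) + 1) ^ (2 * (H / 2 + 1 / 4)) + ((n : ℝ) - 1) ^ (2 * (H / 2 + 1 / 4))
    - 2 * (n : ℝ) ^ (2 * (H / 2 + 1 / 4)))

/-- The series `∑_{k ≥ 2} ρ(k) ρ(k - 1)`. -/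
def rhoSeries (H : ℝ) : ℝ := ∑' k : ℕ, rho H (k + 2) * rho H (k + 1)

/-- The limit `ϑ = 4 g² ∑_{k ≥ 2} ρ(k) ρ(k - 1) + g² (2^{H + 1/2} - 2)`. -/
def vartheta (σ H : ℝ) : ℝ :=
  4 * gconst σ H ^ 2 * rhoSeries H + gconst σ H ^ 2 * ((2 : ℝ) ^ (H + 1 / 2) - 2)

variable {Ω : Type*}

/-- `𝒴_n = ∑_{i=1}^{n-1} j_n(i) ξ_i`. -/
def Y (σ H : ℝ) (ξ : ℕ → Ω → ℝ) (n : ℕ) (ω : Ω) : ℝ :=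
  ∑ i ∈ Finset.Ico 1 n, jcoef σ H n i * ξ i ω

/-- `X_n = ∑_{i=1}^{n-1} j_n(i) ξ_i + g_n ξ_n`. -/
def X (σ H : ℝ) (ξ : ℕ → Ω → ℝ) (n : ℕ) (ω : Ω) : ℝ :=
  Y σ H ξ n ω + gcoef σ H n * ξ n ω

/-- The stock price of the `N`-fractional binary market (without drift):
`S_0 = s₀` and `S_n = (1 + X_n / N^H) S_{n-1}`. -/
def stock (σ H s₀ : ℝ) (ξ : ℕ → Ω → ℝ) (N : ℕ) : ℕ → Ω → ℝ
  | 0, _ => s₀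
  | n + 1, ω => (1 + X σ H ξ (n + 1) ω / (N : ℝ) ^ H) * stock σ H s₀ ξ N n ω

/-- The position in stock of the strategy `φ^N`: `φ_0 = 0` and `φ_k = N^{H-1} X_k / S_k`. -/
def stockPosition (σ H s₀ : ℝ) (ξ : ℕ → Ω → ℝ) (N k : ℕ) (ω : Ω) : ℝ :=
  if k = 0 then 0 else (N : ℝ) ^ (H - 1) * (X σ H ξ k ω / stock σ H s₀ ξ N k ω)

/-- The position in bond (with constant bond price `1`, no transaction costs, no initial holdings
in bond and stock) that makes the strategy with stock position `φ` and stock price `S`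
self-financing with equality. The first term is the trade at time `0`. -/
def bondPosition (φ S : ℕ → ℝ) (n : ℕ) : ℝ :=
  -(φ 0 * S 0) - ∑ k ∈ Finset.Icc 1 n, (φ k - φ (k - 1)) * S k

/-- The value at time `n` of the self-financing strategy with stock position `φ`, for the stock
price `S`. -/
def portfolioValue (φ S : ℕ → ℝ) (n : ℕ) : ℝ := bondPosition φ S n + φ n * S n

/-- The value `V_n(φ^N)` of the strategy `φ^N` in the `N`-fractional binary market. -/
def V (σ H s₀ : ℝ) (ξ : ℕ → Ω → ℝ) (N n : ℕ) (ω : Ω) : ℝ :=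
  portfolioValue (fun k => stockPosition σ H s₀ ξ N k ω) (fun k => stock σ H s₀ ξ N k ω) n

/-- `𝒮_n^{(1)} = ∑_{k=1}^n g_{k-1} g_k ξ_{k-1} ξ_k`. -/
def S1 (σ H : ℝ) (ξ : ℕ → Ω → ℝ) (n : ℕ) (ω : Ω) : ℝ :=
  ∑ k ∈ Finset.Icc 1 n, gcoef σ H (k - 1) * gcoef σ H k * ξ (k - 1) ω * ξ k ω

/-- `𝒮_n^{(2)} = ∑_{k=1}^n g_k ξ_k 𝒴_{k-1}`. -/
def S2 (σ H : ℝ) (ξ : ℕ → Ω → ℝ) (n : ℕ) (ω : Ω) : ℝ :=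
  ∑ k ∈ Finset.Icc 1 n, gcoef σ H k * ξ k ω * Y σ H ξ (k - 1) ω

/-- `𝒮_n^{(3)} = ∑_{k=1}^n g_{k-1} ξ_{k-1} 𝒴_k`. -/
def S3 (σ H : ℝ) (ξ : ℕ → Ω → ℝ) (n : ℕ) (ω : Ω) : ℝ :=
  ∑ k ∈ Finset.Icc 1 n, gcoef σ H (k - 1) * ξ (k - 1) ω * Y σ H ξ k ω

/-- `𝒮_n^{(4)} = ∑_{k=1}^n 𝒴_{k-1} 𝒴_k`. -/
def S4 (σ H : ℝ) (ξ : ℕ → Ω → ℝ) (n : ℕ) (ω : Ω) : ℝ :=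
  ∑ k ∈ Finset.Icc 1 n, Y σ H ξ (k - 1) ω * Y σ H ξ k ω

/-- Convergence in `L^p(P)` of a sequence of random variables to a constant. -/
def TendstoLp [MeasurableSpace Ω] (P : Measure Ω) (p : ENNReal) (f : ℕ → Ω → ℝ) (c : ℝ) : Prop :=
  (∀ N, MemLp (f N) p P) ∧ Tendsto (fun N => eLpNorm (fun ω => f N ω - c) p P) atTop (𝓝 0)

end FracBinary

end

/-! Each of the four sums is a quadratic form in the signs, with matrix `A N`. Since the squares of
the signs equal 1, its mean is the trace of `A N`, and since the products of two distinct signs are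
orthonormal, its variance is at most twice the squared Hilbert-Schmidt norm. So if the traces
divided by `N` converge and the squared norms are `o(N ^ 2)`, the normalised form converges in `L²`
to the limit of the traces (`IsRademacher.tendstoLp_quadForm`).

The coefficients enter through two facts, with `a = H - 1/2`. Near the diagonal, the factor `(v + n
- 1) ^ a` in the kernel almost cancels `x ^ (-a)`; what remains integrates to a second difference of
`t ^ (a + 1)`, so at fixed lag `m` the coefficient tends to `2 g ρ(m)` (`tendsto_jcoef`), and
likewise `g_n` tends to `g` (`tendsto_gcoef`). Away from the diagonal, the rows have uniformly small
square sums (`exists_tail_bound`).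

`IsTailArray` records these two properties of the array. They imply that the covariances of
consecutive rows converge (`IsTailArray.tendsto_sum_mul`) and, by Cauchy-Schwarz, that the
covariance of two rows tends to zero with their gap, which controls the Hilbert-Schmidt norm for
`S4` (`IsTailArray.tendsto_hilbertSchmidt`). The forms `S1` and `S2` have zero diagonal; the trace
of `S3` sees only lag 1, that of `S4` products of consecutive lags. The almost sure statement for
`S1` follows from the linear growth of its second moment and the boundedness of its increments. -/

noncomputable section

namespace FracBinary

/-! ### Quadratic forms in random signs and their laws of large numbers. -/

/-- An independent sequence of measurable random signs. -/
structure IsRademacher {Ω : Type*} [MeasurableSpace Ω] (e : ℕ → Ω → ℝ) (P : Measure Ω) : Prop where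
  meas : ∀ i, Measurable (e i)
  indep : iIndepFun e P
  plus : ∀ i, P {ω | e i ω = 1} = 1 / 2
  minus : ∀ i, P {ω | e i ω = -1} = 1 / 2

namespace IsRademacher

variable {Ω : Type*} [MeasurableSpace Ω] {P : Measure Ω} [IsProbabilityMeasure P] {e : ℕ → Ω → ℝ}

theorem ae_eq (he : IsRademacher e P) (i : ℕ) : ∀ᵐ ω ∂P, e i ω = 1 ∨ e i ω = -1 := by
  have h1 : MeasurableSet {ω | e i ω = 1} := he.meas i (measurableSet_singleton 1)
  have h2 : MeasurableSet {ω | e i ω = -1} := he.meas i (measurableSet_singleton (-1))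
  have hd : Disjoint {ω | e i ω = 1} {ω | e i ω = -1} := by
    rw [Set.disjoint_left]
    intro ω h h'
    simp only [Set.mem_ofPred_eq] at h h'
    linarith
  have hu : P ({ω | e i ω = 1} ∪ {ω | e i ω = -1}) = 1 := by
    rw [measure_union hd h2, he.plus, he.minus, ENNReal.add_halves]
  have := (prob_compl_eq_zero_iff (h1.union h2)).2 hu
  exact this

theorem ae_sq (he : IsRademacher e P) (i : ℕ) : ∀ᵐ ω ∂P, e i ω * e i ω = 1 := by
  filter_upwards [he.ae_eq i] with ω hω
  rcases hω with h | h <;> rw [h] <;> norm_num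

theorem ae_all (he : IsRademacher e P) : ∀ᵐ ω ∂P, ∀ i, |e i ω| = 1 := by
  rw [ae_all_iff]
  intro i
  filter_upwards [he.ae_eq i] with ω hω
  rcases hω with h | h <;> rw [h] <;> norm_num

theorem integral_eq_zero (he : IsRademacher e P) (i : ℕ) : ∫ ω, e i ω ∂P = 0 := by
  have h1 : MeasurableSet {ω | e i ω = 1} := he.meas i (measurableSet_singleton 1)
  have h2 : MeasurableSet {ω | e i ω = -1} := he.meas i (measurableSet_singleton (-1))
  have : ∫ ω, e i ω ∂P = ∫ ω, ({ω | e i ω = 1}.indicator (fun _ => (1 : ℝ)) ω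
      - {ω | e i ω = -1}.indicator (fun _ => (1 : ℝ)) ω) ∂P := by
    refine integral_congr_ae ?_
    filter_upwards [he.ae_eq i] with ω hω
    rcases hω with h | h <;> simp [Set.indicator, h] <;> norm_num
  rw [this, integral_sub ((integrable_const _).indicator h1) ((integrable_const _).indicator h2),
    integral_indicator_const _ h1, integral_indicator_const _ h2, measureReal_def, measureReal_def,
    he.plus, he.minus, sub_self]

theorem integrable_of_bound {f : Ω → ℝ} (hf : Measurable f) (C : ℝ) (h : ∀ᵐ ω ∂P, |f ω| ≤ C) :
    Integrable f P :=
  Integrable.of_bound hf.aestronglyMeasurable C h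

theorem integral_mul_eq_zero (he : IsRademacher e P) {i j : ℕ} (hij : i ≠ j) :
    ∫ ω, e i ω * e j ω ∂P = 0 := by
  rw [(he.indep.indepFun hij).integral_fun_mul_eq_mul_integral
    (he.meas i).aestronglyMeasurable (he.meas j).aestronglyMeasurable, he.integral_eq_zero, zero_mul]

/-- The indices `i`, `j`, `k` may coincide: a single unmatched sign, independent of the other
factors and centred, kills the expectation. -/
theorem integral_mul_four_eq_zero (he : IsRademacher e P) {i j k l : ℕ} (hi : i ≠ l) (hj : j ≠ l)
    (hk : k ≠ l) : ∫ ω, (e i ω * e j ω * e k ω) * e l ω ∂P = 0 := by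
  have hST : Disjoint ({i, j, k} : Finset ℕ) {l} := by
    simp [hi.symm, hj.symm, hk.symm]
  have h := he.indep.indepFun_finset {i, j, k} {l} hST he.meas
  have hφ : Measurable fun x : (({i, j, k} : Finset ℕ) → ℝ) =>
      x ⟨i, by simp⟩ * x ⟨j, by simp⟩ * x ⟨k, by simp⟩ := by fun_prop
  have hψ : Measurable fun x : (({l} : Finset ℕ) → ℝ) => x ⟨l, by simp⟩ := measurable_pi_apply _
  have h' := h.comp hφ hψ
  have := h'.integral_fun_mul_eq_mul_integral
    (((he.meas i).mul (he.meas j)).mul (he.meas k)).aestronglyMeasurable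
    (he.meas l).aestronglyMeasurable
  have h0 := he.integral_eq_zero l
  simp only [Function.comp_def] at this
  rw [this, h0, mul_zero]

theorem integral_pair_mul_pair (he : IsRademacher e P) {i l p q : ℕ} (hil : i < l) (hpq : p < q) :
    ∫ ω, (e i ω * e l ω) * (e p ω * e q ω) ∂P = if l = q ∧ i = p then 1 else 0 := by
  -- Compare the largest indices of the two pairs. If they differ, the larger one occurs only once;
  -- if they agree, its square is 1 and a product of two signs is left.
  rcases lt_trichotomy l q with h | h | h
  · rw [if_neg (by omega), ← he.integral_mul_four_eq_zero (hil.trans h).ne h.ne hpq.ne]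
    congr 1; ext ω; ring
  · subst h
    have : ∫ ω, (e i ω * e l ω) * (e p ω * e l ω) ∂P = ∫ ω, e i ω * e p ω ∂P := by
      refine integral_congr_ae ?_
      filter_upwards [he.ae_sq l] with ω hω
      linear_combination (e i ω * e p ω) * hω
    rw [this]
    by_cases hip : i = p
    · subst hip
      rw [integral_congr_ae (he.ae_sq i)]
      simp
    · rw [he.integral_mul_eq_zero hip, if_neg (by tauto)]
  · rw [if_neg (by omega), ← he.integral_mul_four_eq_zero (hpq.trans h).ne h.ne hil.ne]
    congr 1; ext ω; ring

/-- The off-diagonal monomials `e i * e l`, `i < l`, are orthonormal. -/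
theorem integral_sq_sum_pairs (he : IsRademacher e P) (N : ℕ) (b : (Σ _ : ℕ, ℕ) → ℝ) :
    ∫ ω, (∑ x ∈ (Finset.range N).sigma (fun l => Finset.range l),
      b x * (e x.2 ω * e x.1 ω)) ^ 2 ∂P =
      ∑ x ∈ (Finset.range N).sigma (fun l => Finset.range l), b x ^ 2 := by
  have hint : ∀ x y : (Σ _ : ℕ, ℕ), Integrable (fun ω => (b x * (e x.2 ω * e x.1 ω)) *
      (b y * (e y.2 ω * e y.1 ω))) P := by
    intro x y
    have := he.meas
    refine integrable_of_bound (by fun_prop) (|b x| * |b y|) ?_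
    filter_upwards [he.ae_all] with ω hω
    simp only [abs_mul, hω, mul_one]
    exact le_rfl
  simp_rw [sq (Finset.sum _ _), Finset.sum_mul_sum]
  rw [integral_finsetSum _ fun x _ => integrable_finsetSum _ fun y _ => hint x y]
  refine Finset.sum_congr rfl fun x hx => ?_
  rw [integral_finsetSum _ fun y _ => hint x y]
  have hx' : x.2 < x.1 := by simpa using (Finset.mem_sigma.1 hx).2
  rw [Finset.sum_eq_single_of_mem x hx]
  · have h1 := he.integral_pair_mul_pair hx' hx'
    rw [if_pos ⟨rfl, rfl⟩] at h1
    calc _ = ∫ ω, b x ^ 2 * ((e x.2 ω * e x.1 ω) * (e x.2 ω * e x.1 ω)) ∂P := by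
          congr 1; ext ω; ring
      _ = _ := by rw [integral_const_mul, h1, mul_one]
  · intro y hy hyx
    have hy' : y.2 < y.1 := by simpa using (Finset.mem_sigma.1 hy).2
    have h1 := he.integral_pair_mul_pair hx' hy'
    rw [if_neg] at h1
    · calc _ = ∫ ω, (b x * b y) * ((e x.2 ω * e x.1 ω) * (e y.2 ω * e y.1 ω)) ∂P := by
            congr 1; ext ω; ring
        _ = _ := by rw [integral_const_mul, h1, mul_zero]
    · rintro ⟨h, h'⟩
      apply hyx
      rcases x with ⟨x1, x2⟩
      rcases y with ⟨y1, y2⟩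
      simp only at h h'
      subst h h'
      rfl

end IsRademacher

theorem sum_range_sum_range_eq (N : ℕ) (B : ℕ → ℕ → ℝ) :
    ∑ i ∈ Finset.range N, ∑ l ∈ Finset.range N, B i l =
      ∑ i ∈ Finset.range N, B i i +
        ∑ l ∈ Finset.range N, ∑ i ∈ Finset.range l, (B i l + B l i) := by
  induction N with
  | zero => simp
  | succ n ih =>
    simp only [Finset.sum_range_succ, Finset.sum_add_distrib] at ih ⊢
    linarith

namespace IsRademacher

variable {Ω : Type*} [MeasurableSpace Ω] {P : Measure Ω} [IsProbabilityMeasure P] {e : ℕ → Ω → ℝ}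

/-- Variance bound for a quadratic form in random signs. -/
theorem integral_sq_quadForm_le (he : IsRademacher e P) (N : ℕ) (A : ℕ → ℕ → ℝ) :
    ∫ ω, (∑ i ∈ Finset.range N, ∑ l ∈ Finset.range N, A i l * (e i ω * e l ω)
        - ∑ i ∈ Finset.range N, A i i) ^ 2 ∂P ≤
      2 * ∑ i ∈ Finset.range N, ∑ l ∈ Finset.range N, A i l ^ 2 := by
  have h1 : ∫ ω, (∑ i ∈ Finset.range N, ∑ l ∈ Finset.range N, A i l * (e i ω * e l ω)
        - ∑ i ∈ Finset.range N, A i i) ^ 2 ∂P =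
      ∫ ω, (∑ x ∈ (Finset.range N).sigma (fun l => Finset.range l),
        (A x.2 x.1 + A x.1 x.2) * (e x.2 ω * e x.1 ω)) ^ 2 ∂P := by
    refine integral_congr_ae ?_
    -- Almost surely the diagonal part is exactly the trace, so centring leaves the symmetrised
    -- off-diagonal part; the factor 2 of the bound then comes from `(x + y) ^ 2 ≤ 2 * (x ^ 2 + y ^
    -- 2)`.
    filter_upwards [ae_all_iff.2 he.ae_sq] with ω hω
    congr 1
    rw [sum_range_sum_range_eq, Finset.sum_sigma]
    simp only [hω, mul_one, add_sub_cancel_left]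
    refine Finset.sum_congr rfl fun l _ => Finset.sum_congr rfl fun i _ => ?_
    ring
  rw [h1, he.integral_sq_sum_pairs N (fun x => A x.2 x.1 + A x.1 x.2),
    sum_range_sum_range_eq N (fun i l => A i l ^ 2), Finset.sum_sigma, mul_add, Finset.mul_sum]
  simp only [Finset.mul_sum]
  have h0 : 0 ≤ ∑ i ∈ Finset.range N, 2 * A i i ^ 2 :=
    Finset.sum_nonneg fun i _ => by positivity
  have h2 : ∑ l ∈ Finset.range N, ∑ i ∈ Finset.range l, (A i l + A l i) ^ 2 ≤
      ∑ l ∈ Finset.range N, ∑ i ∈ Finset.range l, 2 * (A i l ^ 2 + A l i ^ 2) := by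
    refine Finset.sum_le_sum fun l _ => Finset.sum_le_sum fun i _ => ?_
    nlinarith [sq_nonneg (A i l - A l i)]
  linarith

theorem measurable_quadForm {μ : Measure Ω} (he : IsRademacher e μ) (N : ℕ) (A : ℕ → ℕ → ℝ) :
    Measurable fun ω => ∑ i ∈ Finset.range N, ∑ l ∈ Finset.range N, A i l * (e i ω * e l ω) := by
  have := he.meas
  fun_prop

theorem ae_abs_quadForm_le (he : IsRademacher e P) (N : ℕ) (A : ℕ → ℕ → ℝ) :
    ∀ᵐ ω ∂P, |∑ i ∈ Finset.range N, ∑ l ∈ Finset.range N, A i l * (e i ω * e l ω)| ≤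
      ∑ i ∈ Finset.range N, ∑ l ∈ Finset.range N, |A i l| := by
  filter_upwards [he.ae_all] with ω hω
  refine (Finset.abs_sum_le_sum_abs _ _).trans (Finset.sum_le_sum fun i _ => ?_)
  refine (Finset.abs_sum_le_sum_abs _ _).trans (Finset.sum_le_sum fun l _ => ?_)
  simp [abs_mul, hω]

end IsRademacher

variable {Ω : Type*} [MeasurableSpace Ω] {P : Measure Ω} [IsProbabilityMeasure P]

theorem eLpNorm_two_eq {μ : Measure Ω} {f : Ω → ℝ} (hf : MemLp f 2 μ) :
    eLpNorm f 2 μ = ENNReal.ofReal (Real.sqrt (∫ ω, f ω ^ 2 ∂μ)) := by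
  rw [hf.eLpNorm_eq_integral_rpow_norm (by norm_num) (by norm_num), Real.sqrt_eq_rpow]
  simp

/-- Quadratic forms in random signs whose normalised traces converge and whose squared
Hilbert-Schmidt norms are `o(N ^ 2)` satisfy a law of large numbers in `L²`. -/
theorem IsRademacher.tendstoLp_quadForm {e : ℕ → Ω → ℝ} (he : IsRademacher e P)
    (A : ℕ → ℕ → ℕ → ℝ) (c : ℝ)
    (htr : Tendsto (fun N : ℕ => 1 / (N : ℝ) * ∑ i ∈ Finset.range N, A N i i) atTop (𝓝 c))
    (hHS : Tendsto (fun N : ℕ => 1 / (N : ℝ) ^ 2 *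
      ∑ i ∈ Finset.range N, ∑ l ∈ Finset.range N, A N i l ^ 2) atTop (𝓝 0)) :
    TendstoLp P 2 (fun N ω => 1 / (N : ℝ) *
      ∑ i ∈ Finset.range N, ∑ l ∈ Finset.range N, A N i l * (e i ω * e l ω)) c := by
  set Q : ℕ → Ω → ℝ := fun N ω =>
    ∑ i ∈ Finset.range N, ∑ l ∈ Finset.range N, A N i l * (e i ω * e l ω) with hQ
  set t : ℕ → ℝ := fun N => ∑ i ∈ Finset.range N, A N i i with ht
  have hQm : ∀ N, Measurable (Q N) := fun N => he.measurable_quadForm N (A N)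
  have hmem : ∀ N (u v : ℝ), MemLp (fun ω => u * Q N ω - v) 2 P := by
    intro N u v
    obtain hb := he.ae_abs_quadForm_le N (A N)
    refine MemLp.of_bound (((hQm N).const_mul u).sub_const v).aestronglyMeasurable
      (|u| * (∑ i ∈ Finset.range N, ∑ l ∈ Finset.range N, |A N i l|) + |v|) ?_
    filter_upwards [hb] with ω hω
    rw [Real.norm_eq_abs]
    refine (abs_sub _ _).trans ?_
    rw [abs_mul]
    gcongr
  refine ⟨fun N => by simpa using hmem N (1 / (N : ℝ)) 0, ?_⟩
  have hbound : ∀ N : ℕ, eLpNorm (fun ω => 1 / (N : ℝ) * Q N ω - c) 2 P ≤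
      ENNReal.ofReal (Real.sqrt (2 * (1 / (N : ℝ) ^ 2 *
        ∑ i ∈ Finset.range N, ∑ l ∈ Finset.range N, A N i l ^ 2)))
      + ENNReal.ofReal |1 / (N : ℝ) * t N - c| := by
    intro N
    -- Fluctuation around the trace plus deterministic bias.
    have hsplit : (fun ω => 1 / (N : ℝ) * Q N ω - c) =
        (fun ω => 1 / (N : ℝ) * Q N ω - 1 / (N : ℝ) * t N) +
          fun _ => (1 / (N : ℝ) * t N - c) := by
      ext ω; simp
    rw [hsplit]
    refine (eLpNorm_add_le (hmem N _ _).1 aestronglyMeasurable_const (by norm_num)).trans ?_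
    gcongr
    · rw [eLpNorm_two_eq (hmem N _ _)]
      refine ENNReal.ofReal_le_ofReal (Real.sqrt_le_sqrt ?_)
      have : ∀ ω, (1 / (N : ℝ) * Q N ω - 1 / (N : ℝ) * t N) ^ 2 =
          1 / (N : ℝ) ^ 2 * (Q N ω - t N) ^ 2 := fun ω => by ring
      simp_rw [this]
      rw [integral_const_mul, mul_left_comm]
      gcongr
      exact he.integral_sq_quadForm_le N (A N)
    · rw [eLpNorm_const _ (by norm_num) (NeZero.ne P)]
      simp [Real.enorm_eq_ofReal_abs]
  refine tendsto_of_tendsto_of_tendsto_of_le_of_le tendsto_const_nhds ?_ (fun _ => zero_le) hbound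
  have h1 : Tendsto (fun N : ℕ => Real.sqrt (2 * (1 / (N : ℝ) ^ 2 *
        ∑ i ∈ Finset.range N, ∑ l ∈ Finset.range N, A N i l ^ 2))) atTop (𝓝 0) := by
    have := (hHS.const_mul 2).sqrt
    simpa using this
  have h2 : Tendsto (fun N : ℕ => |1 / (N : ℝ) * t N - c|) atTop (𝓝 0) := by
    have := (htr.sub_const c).abs
    simpa using this
  have h3 := (ENNReal.tendsto_ofReal h1).add (ENNReal.tendsto_ofReal h2)
  simpa using h3

/-- A sequence of partial sums of bounded terms whose second moments grow at most linearly
satisfies the strong law of large numbers. -/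
theorem ae_tendsto_div_of_integral_sq_le {T : ℕ → Ω → ℝ} (hm : ∀ n, Measurable (T n)) {C D : ℝ}
    (hzero : ∀ ω, T 0 ω = 0)
    (hinc : ∀ᵐ ω ∂P, ∀ n, |T (n + 1) ω - T n ω| ≤ C)
    (hsq : ∀ n, ∫ ω, T n ω ^ 2 ∂P ≤ D * n) :
    ∀ᵐ ω ∂P, Tendsto (fun N : ℕ => 1 / (N : ℝ) * T N ω) atTop (𝓝 0) := by
  have hb : ∀ᵐ ω ∂P, ∀ n : ℕ, |T n ω| ≤ C * n := by
    filter_upwards [hinc] with ω hω n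
    induction n with
    | zero => simp [hzero]
    | succ n ih =>
      have := abs_add_le (T (n + 1) ω - T n ω) (T n ω)
      rw [sub_add_cancel] at this
      push_cast
      linarith [hω n]
  have hint : ∀ n, Integrable (fun ω => T n ω ^ 2) P := by
    intro n
    refine IsRademacher.integrable_of_bound ((hm n).pow_const 2) ((C * n) ^ 2) ?_
    filter_upwards [hb] with ω hω
    rw [abs_pow]
    exact pow_le_pow_left₀ (abs_nonneg _) (hω n) 2
  -- Along the squares the second moments of the averages are at most `D / n ^ 2`, hence summable.
  have hsum : ∀ᵐ ω ∂P, Summable fun n : ℕ => (1 / ((n : ℝ) ^ 2) * T (n ^ 2) ω) ^ 2 := by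
    have hi : ∀ n : ℕ, Integrable (fun ω => (1 / ((n : ℝ) ^ 2) * T (n ^ 2) ω) ^ 2) P := by
      intro n
      have := (hint (n ^ 2)).const_mul ((1 / ((n : ℝ) ^ 2)) ^ 2)
      simpa only [mul_pow] using this
    have hfin : ∑' n : ℕ, ∫⁻ ω, ENNReal.ofReal ((1 / ((n : ℝ) ^ 2) * T (n ^ 2) ω) ^ 2) ∂P ≠ ⊤ := by
      have hle : ∀ n : ℕ, ∫⁻ ω, ENNReal.ofReal ((1 / ((n : ℝ) ^ 2) * T (n ^ 2) ω) ^ 2) ∂P ≤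
          ENNReal.ofReal (D * (1 / (n : ℝ) ^ 2)) := by
        intro n
        rw [← ofReal_integral_eq_lintegral_ofReal (hi n) (ae_of_all _ fun ω => sq_nonneg _)]
        refine ENNReal.ofReal_le_ofReal ?_
        simp_rw [mul_pow]
        rw [integral_const_mul]
        refine (mul_le_mul_of_nonneg_left (hsq (n ^ 2)) (by positivity)).trans (le_of_eq ?_)
        rcases eq_or_ne n 0 with rfl | hn
        · simp
        · have : (n : ℝ) ≠ 0 := by exact_mod_cast hn
          push_cast
          field_simp
      have hD : 0 ≤ D := by
        have := hsq 1
        have h0 : 0 ≤ ∫ ω, T 1 ω ^ 2 ∂P := integral_nonneg fun ω => sq_nonneg _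
        simp only [Nat.cast_one, mul_one] at this
        linarith
      refine ne_top_of_le_ne_top ?_ (ENNReal.tsum_le_tsum hle)
      have hs : Summable fun n : ℕ => D * (1 / (n : ℝ) ^ 2) :=
        (Real.summable_one_div_nat_pow.2 (by norm_num)).mul_left D
      exact hs.tsum_ofReal_ne_top
    rw [← lintegral_tsum fun n => ((hi n).1.aemeasurable.ennreal_ofReal)] at hfin
    have := ae_lt_top' (AEMeasurable.tsum fun n => ((hi n).1.aemeasurable.ennreal_ofReal)) hfin
    filter_upwards [this] with ω hω
    have h2 := ENNReal.summable_toReal hω.ne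
    simpa only [ENNReal.toReal_ofReal (sq_nonneg _)] using h2
  filter_upwards [hinc, hsum] with ω hω hs
  have hsub : Tendsto (fun n : ℕ => 1 / ((n : ℝ) ^ 2) * T (n ^ 2) ω) atTop (𝓝 0) := by
    have h1 := hs.tendsto_atTop_zero.sqrt
    simp only [Real.sqrt_sq_eq_abs, Real.sqrt_zero] at h1
    exact (tendsto_zero_iff_abs_tendsto_zero _).2 h1
  -- Adding the drift `C * n` makes the sequence monotone, so its averages converge as soon as they
  -- do along the squares, whose consecutive ratios tend to 1.
  have hmono : Monotone fun n : ℕ => T n ω + C * n := by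
    refine monotone_nat_of_le_succ fun n => ?_
    have := (abs_le.1 (hω n)).1
    push_cast
    linarith
  have hlim := tendsto_div_of_monotone_of_exists_subseq_tendsto_div _ C hmono (by
    intro a ha
    refine ⟨fun n => n ^ 2, ?_, tendsto_pow_atTop (by norm_num), ?_⟩
    · have h1 : Tendsto (fun n : ℕ => (1 + 1 / (n : ℝ)) ^ 2) atTop (𝓝 1) := by
        have := (tendsto_one_div_atTop_nhds_zero_nat (𝕜 := ℝ)).const_add 1
        simpa using this.pow 2
      filter_upwards [h1.eventually_le_const ha, eventually_gt_atTop 0] with n hn hn0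
      have hn' : (0 : ℝ) < n := by exact_mod_cast hn0
      push_cast
      calc ((n : ℝ) + 1) ^ 2 = (1 + 1 / (n : ℝ)) ^ 2 * (n : ℝ) ^ 2 := by field_simp
        _ ≤ a * (n : ℝ) ^ 2 := by gcongr
    · have h2 := hsub.add_const C
      rw [zero_add] at h2
      refine h2.congr' ?_
      filter_upwards [eventually_gt_atTop 0] with n hn0
      have hn' : (n : ℝ) ≠ 0 := by exact_mod_cast hn0.ne'
      push_cast
      field_simp)
  have h3 := hlim.sub_const C
  rw [sub_self] at h3
  refine h3.congr' ?_
  filter_upwards [eventually_gt_atTop 0] with n hn0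
  have hn' : (n : ℝ) ≠ 0 := by exact_mod_cast hn0.ne'
  field_simp
  ring

/-! ### Estimates of the kernel integrals, with `a = H - 1/2`. -/

/-- The inner integral of `jcoef`. -/
def jInner (a n x : ℝ) : ℝ := ∫ v in (0 : ℝ)..1, (v + n - 1) ^ a * (v + n - 1 - x) ^ (a - 1)

/-- The inner integral of `jcoef` without the slowly varying factor. -/
def jMain (a n x : ℝ) : ℝ := ((n - x) ^ a - (n - 1 - x) ^ a) / a

theorem intervalIntegrable_shift_rpow {a : ℝ} (ha : 0 < a) (n x : ℝ) :
    IntervalIntegrable (fun v => (v + n - 1 - x) ^ (a - 1)) volume 0 1 := by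
  have h := (intervalIntegral.intervalIntegrable_rpow' (a := 0 + (n - 1 - x))
    (b := 1 + (n - 1 - x)) (show -1 < a - 1 by linarith)).comp_add_right (n - 1 - x)
  simp only [add_sub_cancel_right] at h
  refine h.congr fun v _ => ?_
  congr 1
  ring

theorem integral_shift_rpow {a : ℝ} (ha : 0 < a) (n x : ℝ) :
    ∫ v in (0 : ℝ)..1, (v + n - 1 - x) ^ (a - 1) = jMain a n x := by
  have h := intervalIntegral.integral_comp_add_right (a := 0) (b := 1)
    (fun v : ℝ => v ^ (a - 1)) (n - 1 - x)
  have h1 : ∫ v in (0 : ℝ)..1, (v + n - 1 - x) ^ (a - 1) =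
      ∫ v in (0 : ℝ)..1, (v + (n - 1 - x)) ^ (a - 1) := by
    congr 1; ext v; congr 1; ring
  rw [h1, h, integral_rpow (Or.inl (by linarith)), jMain]
  congr 3 <;> ring_nf

theorem intervalIntegrable_jInner_integrand {a : ℝ} (ha : 0 < a) (n x : ℝ) :
    IntervalIntegrable (fun v => (v + n - 1) ^ a * (v + n - 1 - x) ^ (a - 1)) volume 0 1 := by
  refine (intervalIntegrable_shift_rpow ha n x).continuousOn_mul ?_
  exact (Continuous.rpow_const (by fun_prop) fun _ => Or.inr ha.le).continuousOn

/-- On the range of integration `x ≤ v + n - 1 ≤ n`. The lower bound `x ^ a` is the one that cancels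
the outer weight `x ^ (-a)` exactly. -/
theorem le_jInner {a n x : ℝ} (ha : 0 < a) (hx : 0 ≤ x) (hxn : x ≤ n - 1) :
    x ^ a * jMain a n x ≤ jInner a n x := by
  rw [← integral_shift_rpow ha, ← intervalIntegral.integral_const_mul]
  refine intervalIntegral.integral_mono_on zero_le_one
    ((intervalIntegrable_shift_rpow ha n x).const_mul _)
    (intervalIntegrable_jInner_integrand ha n x) fun v hv => ?_
  refine mul_le_mul_of_nonneg_right (Real.rpow_le_rpow hx ?_ ha.le) (Real.rpow_nonneg ?_ _)
  all_goals linarith [hv.1]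

theorem jInner_le {a n x : ℝ} (ha : 0 < a) (hx : 0 ≤ x) (hxn : x ≤ n - 1) :
    jInner a n x ≤ n ^ a * jMain a n x := by
  rw [← integral_shift_rpow ha, ← intervalIntegral.integral_const_mul]
  refine intervalIntegral.integral_mono_on zero_le_one (intervalIntegrable_jInner_integrand ha n x)
    ((intervalIntegrable_shift_rpow ha n x).const_mul _) fun v hv => ?_
  refine mul_le_mul_of_nonneg_right (Real.rpow_le_rpow ?_ ?_ ha.le) (Real.rpow_nonneg ?_ _)
  all_goals linarith [hv.1, hv.2]

theorem jMain_nonneg {a n x : ℝ} (ha : 0 < a) (hxn : x ≤ n - 1) : 0 ≤ jMain a n x := by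
  refine div_nonneg (sub_nonneg.2 (Real.rpow_le_rpow ?_ ?_ ha.le)) ha.le <;> linarith

theorem jMain_le {a n x i : ℝ} (ha : 0 < a) (ha1 : a < 1) (hx : x ≤ i) (hin : i < n - 1) :
    jMain a n x ≤ (n - 1 - i) ^ (a - 1) := by
  rw [← integral_shift_rpow ha]
  calc ∫ v in (0 : ℝ)..1, (v + n - 1 - x) ^ (a - 1) ≤ ∫ v in (0 : ℝ)..1, (n - 1 - i) ^ (a - 1) := by
        refine intervalIntegral.integral_mono_on zero_le_one (intervalIntegrable_shift_rpow ha n x)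
          intervalIntegrable_const fun v hv => ?_
        refine Real.rpow_le_rpow_of_nonpos (by linarith) (by linarith [hv.1]) (by linarith)
    _ = _ := by simp

theorem continuous_jMain {a : ℝ} (ha : 0 < a) (n : ℝ) : Continuous (jMain a n) := by
  have h1 : Continuous fun x : ℝ => (n - x) ^ a :=
    Continuous.rpow_const (by fun_prop) fun _ => Or.inr ha.le
  have h2 : Continuous fun x : ℝ => (n - 1 - x) ^ a :=
    Continuous.rpow_const (by fun_prop) fun _ => Or.inr ha.le
  exact (h1.sub h2).div_const a

/-- Source of `ρ`: since `a + 1 = 2 h`, this second difference is twice the autocovariance at lag `n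
- i`, up to the constant. -/
theorem integral_jMain {a : ℝ} (ha : 0 < a) (n i : ℝ) :
    ∫ x in (i - 1)..i, jMain a n x =
      ((n - i + 1) ^ (a + 1) + (n - i - 1) ^ (a + 1) - 2 * (n - i) ^ (a + 1)) / (a * (a + 1)) := by
  have h1 : Continuous fun x : ℝ => (n - x) ^ a :=
    Continuous.rpow_const (by fun_prop) fun _ => Or.inr ha.le
  have h2 : Continuous fun x : ℝ => (n - 1 - x) ^ a :=
    Continuous.rpow_const (by fun_prop) fun _ => Or.inr ha.le
  have key : ∀ c : ℝ, ∫ x in (i - 1)..i, (c - x) ^ a =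
      ((c - i + 1) ^ (a + 1) - (c - i) ^ (a + 1)) / (a + 1) := by
    intro c
    rw [intervalIntegral.integral_comp_sub_left (fun x : ℝ => x ^ a) c,
      integral_rpow (Or.inl (by linarith))]
    congr 3; ring
  simp only [jMain]
  rw [intervalIntegral.integral_div, intervalIntegral.integral_sub (h1.intervalIntegrable _ _)
    (h2.intervalIntegrable _ _), key, key]
  have e1 : n - 1 - i + 1 = n - i := by ring
  have e2 : n - 1 - i = n - i - 1 := by ring
  rw [e1, e2]
  field_simp
  ring

theorem measurable_jInner (a n : ℝ) : Measurable (jInner a n) := by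
  have h : Measurable (Function.uncurry fun x v : ℝ =>
      (v + n - 1) ^ a * (v + n - 1 - x) ^ (a - 1)) := by
    unfold Function.uncurry
    fun_prop
  have h2 := h.stronglyMeasurable.integral_prod_right (ν := volume.restrict (Set.Ioc (0 : ℝ) 1))
  have h3 : jInner a n = fun x => ∫ v in Set.Ioc (0 : ℝ) 1,
      (v + n - 1) ^ a * (v + n - 1 - x) ^ (a - 1) := by
    ext x
    rw [jInner, intervalIntegral.integral_of_le zero_le_one]
  rw [h3]
  exact h2.measurable

theorem intervalIntegrable_of_le {f g : ℝ → ℝ} {u v : ℝ} (huv : u ≤ v) (hf : Measurable f)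
    (hg : IntervalIntegrable g volume u v) (h : ∀ x ∈ Set.Ioo u v, 0 ≤ f x ∧ f x ≤ g x) :
    IntervalIntegrable f volume u v := by
  rw [intervalIntegrable_iff_integrableOn_Ioo_of_le huv] at hg ⊢
  refine Integrable.mono' hg hf.aestronglyMeasurable ?_
  filter_upwards [ae_restrict_mem measurableSet_Ioo] with x hx
  rw [Real.norm_of_nonneg (h x hx).1]
  exact (h x hx).2

theorem intervalIntegrable_rpow_neg {a : ℝ} (ha1 : a < 1) (u v : ℝ) :
    IntervalIntegrable (fun x : ℝ => x ^ (-a)) volume u v :=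
  intervalIntegral.intervalIntegrable_rpow' (by linarith)

theorem jOuter_nonneg {a n x : ℝ} (ha : 0 < a) (hx : 0 ≤ x) (hxn : x ≤ n - 1) :
    0 ≤ x ^ (-a) * jInner a n x :=
  mul_nonneg (Real.rpow_nonneg hx _)
    ((mul_nonneg (Real.rpow_nonneg hx _) (jMain_nonneg ha hxn)).trans (le_jInner ha hx hxn))

theorem intervalIntegrable_jOuter {a n i : ℝ} (ha : 0 < a) (ha1 : a < 1) (hi : 1 ≤ i)
    (hin : i ≤ n - 1) :
    IntervalIntegrable (fun x => x ^ (-a) * jInner a n x) volume (i - 1) i := by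
  refine intervalIntegrable_of_le (by linarith)
    ((measurable_id.pow_const _).mul (measurable_jInner a n))
    (g := fun x => x ^ (-a) * (n ^ a * jMain a n x)) ?_ fun x hx => ?_
  · exact (intervalIntegrable_rpow_neg ha1 _ _).mul_continuousOn
      ((continuous_jMain ha n).const_mul _).continuousOn
  · have h0 : 0 ≤ x := by linarith [hx.1]
    have h1 : x ≤ n - 1 := by linarith [hx.2]
    exact ⟨jOuter_nonneg ha h0 h1,
      mul_le_mul_of_nonneg_left (jInner_le ha h0 h1) (Real.rpow_nonneg h0 _)⟩

theorem integral_jMain_le {a n i : ℝ} (ha : 0 < a) (ha1 : a < 1) (hi : 1 ≤ i) (hin : i ≤ n - 1) :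
    ∫ x in (i - 1)..i, jMain a n x ≤ ∫ x in (i - 1)..i, x ^ (-a) * jInner a n x := by
  -- The open interval matters for `i = 1`: at `x = 0` the convention `0 ^ (-a) = 0` breaks the
  -- pointwise inequality.
  refine intervalIntegral.integral_mono_on_of_le_Ioo (by linarith)
    ((continuous_jMain ha n).intervalIntegrable _ _) (intervalIntegrable_jOuter ha ha1 hi hin)
    fun x hx => ?_
  have h0 : 0 < x := by linarith [hx.1]
  have h1 : x ≤ n - 1 := by linarith [hx.2]
  calc jMain a n x = x ^ (-a) * (x ^ a * jMain a n x) := by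
        rw [← mul_assoc, ← Real.rpow_add h0]; simp
    _ ≤ _ := mul_le_mul_of_nonneg_left (le_jInner ha h0.le h1) (Real.rpow_nonneg h0.le _)

/-- Upper half of the squeeze: the prefactor tends to 1 when `i` grows with `n - i` fixed. -/
theorem integral_jOuter_le {a n i : ℝ} (ha : 0 < a) (ha1 : a < 1) (hi : 1 < i) (hin : i ≤ n - 1) :
    ∫ x in (i - 1)..i, x ^ (-a) * jInner a n x ≤
      (n / (i - 1)) ^ a * ∫ x in (i - 1)..i, jMain a n x := by
  rw [← intervalIntegral.integral_const_mul]
  refine intervalIntegral.integral_mono_on_of_le_Ioo (by linarith)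
    (intervalIntegrable_jOuter ha ha1 hi.le hin)
    (((continuous_jMain ha n).const_mul _).intervalIntegrable _ _) fun x hx => ?_
  have h0 : 0 < x := by linarith [hx.1]
  have h1 : x ≤ n - 1 := by linarith [hx.2]
  have h2 := jMain_nonneg ha h1
  calc x ^ (-a) * jInner a n x ≤ (i - 1) ^ (-a) * (n ^ a * jMain a n x) := by
        refine mul_le_mul (Real.rpow_le_rpow_of_nonpos (by linarith) hx.1.le (by linarith))
          (jInner_le ha h0.le h1) ?_ (Real.rpow_nonneg (by linarith) _)
        exact (mul_nonneg (Real.rpow_nonneg h0.le _) h2).trans (le_jInner ha h0.le h1)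
    _ = _ := by
        rw [Real.div_rpow (by linarith) (by linarith), Real.rpow_neg (by linarith)]
        ring

/-- The integral is at most `i ^ (-a) / (1 - a)`, because `(1 - 1 / i) ^ (1 - a) ≥ 1 - 1 / i`; the
constant 2 bounds `1 / (1 - a)`. The singular cell `i = 1` is included. -/
theorem integral_rpow_neg_le {a i : ℝ} (ha : 0 < a) (ha1 : a ≤ 1 / 2) (hi : 1 ≤ i) :
    ∫ x in (i - 1)..i, x ^ (-a) ≤ 2 * i ^ (-a) := by
  have hi0 : 0 < i := by linarith
  rw [integral_rpow (Or.inl (by linarith))]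
  have h1 : i ^ (-a + 1) - i ^ (-a) ≤ (i - 1) ^ (-a + 1) := by
    have h2 : i ^ (-a + 1) - i ^ (-a) = i ^ (-a + 1) * (1 - 1 / i) := by
      rw [Real.rpow_add hi0, Real.rpow_one]; field_simp
    have h3 : i - 1 = i * (1 - 1 / i) := by field_simp
    have h4 : 0 ≤ 1 - 1 / i := by
      rw [sub_nonneg, div_le_one hi0]; exact hi
    have h5 : 1 - 1 / i ≤ 1 := by
      have : 0 < 1 / i := by positivity
      linarith
    rw [h2, h3, Real.mul_rpow hi0.le h4]
    refine mul_le_mul_of_nonneg_left ?_ (Real.rpow_nonneg hi0.le _)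
    exact Real.self_le_rpow_of_le_one h4 h5 (by linarith)
  have h6 := Real.rpow_nonneg hi0.le (-a)
  rw [div_le_iff₀ (by linarith)]
  nlinarith

/-- A bound valid far from the diagonal too. Lag at least 2 gives `n - 1 - i ≥ (n - i) / 2`, which
costs a factor 2; the other factor 2 is that of `integral_rpow_neg_le`. -/
theorem integral_jOuter_le_rpow {a n i : ℝ} (ha : 0 < a) (ha1 : a ≤ 1 / 2) (hi : 1 ≤ i)
    (hin : i + 2 ≤ n) :
    ∫ x in (i - 1)..i, x ^ (-a) * jInner a n x ≤
      4 * (n ^ a * (n - i) ^ (a - 1) * i ^ (-a)) := by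
  have hn : 0 ≤ n ^ a := Real.rpow_nonneg (by linarith) _
  have hni : (n - 1 - i) ^ (a - 1) ≤ 2 * (n - i) ^ (a - 1) := by
    calc (n - 1 - i) ^ (a - 1) ≤ ((n - i) / 2) ^ (a - 1) :=
          Real.rpow_le_rpow_of_nonpos (by linarith) (by linarith) (by linarith)
      _ = 2 ^ (1 - a) * (n - i) ^ (a - 1) := by
          rw [Real.div_rpow (by linarith) (by norm_num), show (1 - a) = -(a - 1) by ring,
            Real.rpow_neg (by norm_num)]
          ring
      _ ≤ 2 * (n - i) ^ (a - 1) := by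
          refine mul_le_mul_of_nonneg_right ?_ (Real.rpow_nonneg (by linarith) _)
          calc (2 : ℝ) ^ (1 - a) ≤ 2 ^ (1 : ℝ) :=
                Real.rpow_le_rpow_of_exponent_le (by norm_num) (by linarith)
            _ = 2 := by simp
  calc ∫ x in (i - 1)..i, x ^ (-a) * jInner a n x
      ≤ ∫ x in (i - 1)..i, x ^ (-a) * (n ^ a * (2 * (n - i) ^ (a - 1))) := by
        refine intervalIntegral.integral_mono_on_of_le_Ioo (by linarith)
          (intervalIntegrable_jOuter ha (by linarith) hi (by linarith))
          ((intervalIntegrable_rpow_neg (by linarith) _ _).mul_const _) fun x hx => ?_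
        have h0 : 0 < x := by linarith [hx.1]
        refine mul_le_mul_of_nonneg_left ?_ (Real.rpow_nonneg h0.le _)
        refine (jInner_le ha h0.le (by linarith [hx.2])).trans (mul_le_mul_of_nonneg_left ?_ hn)
        exact (jMain_le ha (by linarith) hx.2.le (by linarith)).trans hni
    _ ≤ 2 * i ^ (-a) * (n ^ a * (2 * (n - i) ^ (a - 1))) := by
        rw [intervalIntegral.integral_mul_const]
        refine mul_le_mul_of_nonneg_right (integral_rpow_neg_le ha ha1 hi) ?_
        have := Real.rpow_nonneg (show 0 ≤ n - i by linarith) (a - 1)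
        positivity
    _ = _ := by ring

/-- The inner integral of `gcoef`. -/
def gInner (a n x : ℝ) : ℝ := ∫ y in (0 : ℝ)..1, (y * (n - x) + x) ^ a * y ^ (a - 1)

theorem integral_unit_rpow {a : ℝ} (ha : 0 < a) : ∫ y in (0 : ℝ)..1, y ^ (a - 1) = 1 / a := by
  rw [integral_rpow (Or.inl (by linarith))]
  simp [ha.ne']

theorem measurable_gInner (a n : ℝ) : Measurable (gInner a n) := by
  have h : Measurable (Function.uncurry fun x y : ℝ =>
      (y * (n - x) + x) ^ a * y ^ (a - 1)) := by
    unfold Function.uncurry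
    fun_prop
  have h2 := h.stronglyMeasurable.integral_prod_right (ν := volume.restrict (Set.Ioc (0 : ℝ) 1))
  have h3 : gInner a n = fun x => ∫ v in Set.Ioc (0 : ℝ) 1,
      (v * (n - x) + x) ^ a * v ^ (a - 1) := by
    ext x
    rw [gInner, intervalIntegral.integral_of_le zero_le_one]
  rw [h3]
  exact h2.measurable

theorem gInner_bounds {a n x : ℝ} (ha : 0 < a) (hx : 0 ≤ x) (hxn : x ≤ n) :
    x ^ a * (1 / a) ≤ gInner a n x ∧ gInner a n x ≤ n ^ a * (1 / a) := by
  have h1 : IntervalIntegrable (fun y : ℝ => y ^ (a - 1)) volume 0 1 :=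
    intervalIntegral.intervalIntegrable_rpow' (by linarith)
  have h2 : IntervalIntegrable (fun y : ℝ => (y * (n - x) + x) ^ a * y ^ (a - 1)) volume 0 1 :=
    h1.continuousOn_mul
      (Continuous.rpow_const (by fun_prop) fun _ => Or.inr ha.le).continuousOn
  rw [← integral_unit_rpow ha, ← intervalIntegral.integral_const_mul,
    ← intervalIntegral.integral_const_mul]
  constructor
  · refine intervalIntegral.integral_mono_on zero_le_one (h1.const_mul _) h2 fun y hy => ?_
    refine mul_le_mul_of_nonneg_right (Real.rpow_le_rpow hx ?_ ha.le) (Real.rpow_nonneg hy.1 _)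
    nlinarith [hy.1]
  · refine intervalIntegral.integral_mono_on zero_le_one h2 (h1.const_mul _) fun y hy => ?_
    refine mul_le_mul_of_nonneg_right (Real.rpow_le_rpow ?_ ?_ ha.le) (Real.rpow_nonneg hy.1 _)
    · nlinarith [hy.1]
    · nlinarith [hy.1, hy.2]

/-- The same squeeze as for `jInner`: `y * (n - x) + x` lies between `x` and `n`, and the lower
bound again cancels `x ^ (-a)`. -/
theorem integral_gOuter_bounds {a n : ℝ} (ha : 0 < a) (hn : 1 < n) :
    1 / (a * (a + 1)) ≤ ∫ x in (n - 1)..n, x ^ (-a) * (n - x) ^ a * gInner a n x ∧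
    ∫ x in (n - 1)..n, x ^ (-a) * (n - x) ^ a * gInner a n x ≤
      (n / (n - 1)) ^ a * (1 / (a * (a + 1))) := by
  have hcont : Continuous fun x : ℝ => (n - x) ^ a :=
    Continuous.rpow_const (by fun_prop) fun _ => Or.inr ha.le
  have hint : ∫ x in (n - 1)..n, (n - x) ^ a * (1 / a) = 1 / (a * (a + 1)) := by
    rw [intervalIntegral.integral_mul_const,
      intervalIntegral.integral_comp_sub_left (fun x : ℝ => x ^ a) n,
      integral_rpow (Or.inl (by linarith))]
    have : (0 : ℝ) ^ (a + 1) = 0 := Real.zero_rpow (by linarith)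
    simp [this]
  have hb : ∀ x ∈ Set.Ioo (n - 1) n,
      (n - x) ^ a * (1 / a) ≤ x ^ (-a) * (n - x) ^ a * gInner a n x ∧
      x ^ (-a) * (n - x) ^ a * gInner a n x ≤ (n / (n - 1)) ^ a * ((n - x) ^ a * (1 / a)) := by
    intro x hx
    have h0 : 0 < x := by linarith [hx.1]
    have hg := gInner_bounds ha h0.le hx.2.le
    have h1 : 0 ≤ (n - x) ^ a := Real.rpow_nonneg (by linarith [hx.2]) _
    have h2 : 0 ≤ x ^ (-a) := Real.rpow_nonneg h0.le _
    constructor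
    · calc (n - x) ^ a * (1 / a) = x ^ (-a) * (n - x) ^ a * (x ^ a * (1 / a)) := by
            rw [Real.rpow_neg h0.le]
            have := (Real.rpow_pos_of_pos h0 a).ne'
            field_simp
        _ ≤ _ := mul_le_mul_of_nonneg_left hg.1 (by positivity)
    · have hn0 : 0 ≤ n ^ a := Real.rpow_nonneg (by linarith) _
      calc x ^ (-a) * (n - x) ^ a * gInner a n x
          ≤ (n - 1) ^ (-a) * (n - x) ^ a * (n ^ a * (1 / a)) := by
            have h3 : x ^ (-a) ≤ (n - 1) ^ (-a) :=
              Real.rpow_le_rpow_of_nonpos (by linarith) hx.1.le (by linarith)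
            refine mul_le_mul (mul_le_mul_of_nonneg_right h3 h1) hg.2 ?_ ?_
            · refine le_trans ?_ hg.1
              have := Real.rpow_nonneg h0.le a
              positivity
            · exact mul_nonneg (h2.trans h3) h1
        _ = _ := by
            rw [Real.div_rpow (by linarith) (by linarith), Real.rpow_neg (by linarith)]
            ring
  have hint1 : IntervalIntegrable (fun x => (n - x) ^ a * (1 / a)) volume (n - 1) n :=
    (hcont.mul_const _).intervalIntegrable _ _
  have hint2 : IntervalIntegrable (fun x => (n / (n - 1)) ^ a * ((n - x) ^ a * (1 / a)))
      volume (n - 1) n := hint1.const_mul _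
  have hint3 : IntervalIntegrable (fun x => x ^ (-a) * (n - x) ^ a * gInner a n x)
      volume (n - 1) n := by
    refine intervalIntegrable_of_le (by linarith) ?_ hint2 fun x hx => ⟨?_, (hb x hx).2⟩
    · have := measurable_gInner a n
      fun_prop
    · refine le_trans ?_ (hb x hx).1
      have : 0 ≤ (n - x) ^ a := Real.rpow_nonneg (by linarith [hx.2]) _
      positivity
  rw [← hint, ← intervalIntegral.integral_const_mul]
  exact ⟨intervalIntegral.integral_mono_on_of_le_Ioo (by linarith) hint1 hint3
      fun x hx => (hb x hx).1,
    intervalIntegral.integral_mono_on_of_le_Ioo (by linarith) hint3 hint2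
      fun x hx => (hb x hx).2⟩

/-! ### Limits of the coefficients at fixed lag. -/

theorem cH_pos {H : ℝ} (hH : 1 / 2 < H) (hH1 : H < 1) : 0 < cH H := by
  have h1 : 0 < Real.Gamma (3 / 2 - H) := Real.Gamma_pos_of_pos (by linarith)
  have h2 : 0 < Real.Gamma (H + 1 / 2) := Real.Gamma_pos_of_pos (by linarith)
  have h3 : 0 < Real.Gamma (2 - 2 * H) := Real.Gamma_pos_of_pos (by linarith)
  refine Real.sqrt_pos.2 (div_pos ?_ (mul_pos h2 h3))
  have : 0 < 2 * H := by linarith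
  positivity

theorem gconst_pos {σ H : ℝ} (hσ : 0 < σ) (hH : 1 / 2 < H) (hH1 : H < 1) : 0 < gconst σ H :=
  div_pos (mul_pos hσ (cH_pos hH hH1)) (by linarith)

theorem mul_CH_pos {σ H : ℝ} (hσ : 0 < σ) (hH : 1 / 2 < H) (hH1 : H < 1) : 0 < σ * CH H :=
  mul_pos hσ (mul_pos (by linarith) (cH_pos hH hH1))

theorem mul_CH_eq {σ H : ℝ} (hH : 1 / 2 < H) :
    σ * CH H * (1 / ((H - 1 / 2) * (H - 1 / 2 + 1))) = gconst σ H := by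
  have h1 : H - 1 / 2 ≠ 0 := by linarith
  have h2 : H - 1 / 2 + 1 ≠ 0 := by linarith
  rw [gconst, CH, show H + 1 / 2 = H - 1 / 2 + 1 by ring]
  generalize H - 1 / 2 = a at h1 h2 ⊢
  field_simp

theorem jcoef_eq (σ H : ℝ) (n i : ℕ) :
    jcoef σ H n i = σ * CH H *
      ∫ x in ((i : ℝ) - 1)..(i : ℝ), x ^ (-(H - 1 / 2)) * jInner (H - 1 / 2) n x := by
  simp only [jcoef, jInner]
  rw [show (1 / 2 - H) = -(H - 1 / 2) by ring, show (H - 3 / 2) = H - 1 / 2 - 1 by ring]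

theorem gcoef_eq (σ H : ℝ) {n : ℕ} (hn : n ≠ 0) :
    gcoef σ H n = σ * CH H * ∫ x in ((n : ℝ) - 1)..(n : ℝ),
      x ^ (-(H - 1 / 2)) * ((n : ℝ) - x) ^ (H - 1 / 2) * gInner (H - 1 / 2) n x := by
  simp only [gcoef, gInner, if_neg hn]
  rw [show (1 / 2 - H) = -(H - 1 / 2) by ring, show (H - 3 / 2) = H - 1 / 2 - 1 by ring]

theorem tendsto_ratio_rpow (a c : ℝ) :
    Tendsto (fun n : ℕ => (((n : ℝ) + c) / n) ^ a) atTop (𝓝 1) := by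
  have h1 : Tendsto (fun n : ℕ => ((n : ℝ) + c) / n) atTop (𝓝 1) := by
    have h := (tendsto_const_div_atTop_nhds_zero_nat c).const_add 1
    rw [add_zero] at h
    refine h.congr' ?_
    filter_upwards [eventually_gt_atTop 0] with n hn
    have : (n : ℝ) ≠ 0 := by exact_mod_cast hn.ne'
    field_simp
  have := h1.rpow_const (p := a) (Or.inl one_ne_zero)
  simpa using this

theorem tendsto_gcoef {σ H : ℝ} (hσ : 0 < σ) (hH : 1 / 2 < H) (hH1 : H < 1) :
    Tendsto (fun n : ℕ => gcoef σ H (n + 1)) atTop (𝓝 (gconst σ H)) := by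
  have ha : 0 < H - 1 / 2 := by linarith
  have hK := mul_CH_pos hσ hH hH1
  have hup : Tendsto (fun n : ℕ => (((n : ℝ) + 1) / n) ^ (H - 1 / 2) * gconst σ H) atTop
      (𝓝 (gconst σ H)) := by
    simpa using (tendsto_ratio_rpow (H - 1 / 2) 1).mul_const (gconst σ H)
  refine tendsto_of_tendsto_of_tendsto_of_le_of_le' tendsto_const_nhds hup ?_ ?_
  all_goals
    filter_upwards [eventually_gt_atTop 0] with n hn
    have hn' : (0 : ℝ) < n := by exact_mod_cast hn
    have hb := integral_gOuter_bounds (n := ((n + 1 : ℕ) : ℝ)) ha (by push_cast; linarith)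
    rw [gcoef_eq σ H (Nat.succ_ne_zero n), ← mul_CH_eq (σ := σ) hH]
  · exact mul_le_mul_of_nonneg_left hb.1 hK.le
  · have h2 := mul_le_mul_of_nonneg_left hb.2 hK.le
    refine h2.trans (le_of_eq ?_)
    push_cast
    rw [add_sub_cancel_right]
    ring

theorem rho_eq (H : ℝ) (m : ℕ) : rho H m =
    1 / 2 * (((m : ℝ) + 1) ^ (H - 1 / 2 + 1) + ((m : ℝ) - 1) ^ (H - 1 / 2 + 1)
      - 2 * (m : ℝ) ^ (H - 1 / 2 + 1)) := by
  rw [rho, show 2 * (H / 2 + 1 / 4) = H - 1 / 2 + 1 by ring]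

theorem mul_CH_integral_jMain {σ H : ℝ} (hH : 1 / 2 < H) (i m : ℕ) :
    σ * CH H * ∫ x in ((i : ℝ) - 1)..(i : ℝ), jMain (H - 1 / 2) ((i : ℝ) + m) x =
      2 * gconst σ H * rho H m := by
  rw [integral_jMain (by linarith), ← mul_CH_eq hH, rho_eq, add_sub_cancel_left]
  ring

theorem le_jcoef {σ H : ℝ} (hσ : 0 < σ) (hH : 1 / 2 < H) (hH1 : H < 1) {i m : ℕ}
    (hi : 1 ≤ i) (hm : 1 ≤ m) : 2 * gconst σ H * rho H m ≤ jcoef σ H (i + m) i := by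
  have hi' : (1 : ℝ) ≤ i := by exact_mod_cast hi
  have hm' : (1 : ℝ) ≤ m := by exact_mod_cast hm
  rw [← mul_CH_integral_jMain hH i m, jcoef_eq, Nat.cast_add]
  exact mul_le_mul_of_nonneg_left
    (integral_jMain_le (by linarith) (by linarith) hi' (by linarith)) (mul_CH_pos hσ hH hH1).le

theorem jcoef_le {σ H : ℝ} (hσ : 0 < σ) (hH : 1 / 2 < H) (hH1 : H < 1) {i m : ℕ}
    (hi : 1 ≤ i) (hm : 1 ≤ m) : jcoef σ H (i + 1 + m) (i + 1) ≤
      (((i : ℝ) + (1 + m)) / i) ^ (H - 1 / 2) * (2 * gconst σ H * rho H m) := by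
  have hi' : (1 : ℝ) ≤ i := by exact_mod_cast hi
  have hm' : (1 : ℝ) ≤ m := by exact_mod_cast hm
  have h := integral_jOuter_le (a := H - 1 / 2) (n := ((i + 1 + m : ℕ) : ℝ)) (i := ((i + 1 : ℕ) : ℝ))
    (by linarith) (by linarith) (by push_cast; linarith) (by push_cast; linarith)
  rw [← mul_CH_integral_jMain hH (i + 1) m, jcoef_eq, ← Nat.cast_add (i + 1) m]
  refine (mul_le_mul_of_nonneg_left h (mul_CH_pos hσ hH hH1).le).trans (le_of_eq ?_)
  push_cast
  rw [add_sub_cancel_right, add_assoc]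
  ring

theorem tendsto_jcoef {σ H : ℝ} (hσ : 0 < σ) (hH : 1 / 2 < H) (hH1 : H < 1) {m : ℕ} (hm : 1 ≤ m) :
    Tendsto (fun i : ℕ => jcoef σ H (i + 1 + m) (i + 1)) atTop (𝓝 (2 * gconst σ H * rho H m)) := by
  have hup := (tendsto_ratio_rpow (H - 1 / 2) (1 + m)).mul_const (2 * gconst σ H * rho H m)
  rw [one_mul] at hup
  refine tendsto_of_tendsto_of_tendsto_of_le_of_le' tendsto_const_nhds hup ?_ ?_
  · exact Eventually.of_forall fun i => le_jcoef hσ hH hH1 (by omega) hm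
  · filter_upwards [eventually_ge_atTop 1] with i hi
    exact jcoef_le hσ hH hH1 hi hm

/-- Strict convexity of `t ↦ t ^ (H + 1/2)` on the half-line. -/
theorem rho_pos {H : ℝ} (hH : 1 / 2 < H) {m : ℕ} (hm : 1 ≤ m) : 0 < rho H m := by
  have hm' : (1 : ℝ) ≤ m := by exact_mod_cast hm
  have hc : StrictConvexOn ℝ (Set.Ici 0) fun x : ℝ => x ^ (H - 1 / 2 + 1) :=
    strictConvexOn_rpow (by linarith)
  have h := hc.2 (Set.mem_Ici.2 (show (0 : ℝ) ≤ (m : ℝ) - 1 by linarith))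
    (Set.mem_Ici.2 (show (0 : ℝ) ≤ (m : ℝ) + 1 by linarith)) (by linarith)
    (show (0 : ℝ) < 1 / 2 by norm_num) (show (0 : ℝ) < 1 / 2 by norm_num) (by norm_num)
  simp only [smul_eq_mul] at h
  rw [show 1 / 2 * ((m : ℝ) - 1) + 1 / 2 * ((m : ℝ) + 1) = m by ring] at h
  rw [rho_eq]
  linarith

theorem jcoef_nonneg {σ H : ℝ} (hσ : 0 < σ) (hH : 1 / 2 < H) (hH1 : H < 1) {n i : ℕ}
    (hi : 1 ≤ i) (hn : i < n) : 0 ≤ jcoef σ H n i := by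
  obtain ⟨m, rfl⟩ := Nat.exists_eq_add_of_lt hn
  have hm : 1 ≤ m + 1 := by omega
  have h0 := le_jcoef (m := m + 1) hσ hH hH1 hi hm
  have h1 := gconst_pos hσ hH hH1
  have h2 := rho_pos hH hm
  exact le_trans (by positivity) h0

/-! ### Uniform square summability of the rows. -/

/-- The array `j_n(i + 1)`, extended by zero. -/
def jArr (σ H : ℝ) (n i : ℕ) : ℝ := if i + 1 < n then jcoef σ H n (i + 1) else 0

theorem jArr_of_le {σ H : ℝ} {n i : ℕ} (h : n ≤ i + 1) : jArr σ H n i = 0 :=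
  if_neg (by omega)

/-- Column `n` stands for the sign of index `n + 1`, so row `n + m + 2` meets it at lag `m + 1`. -/
theorem tendsto_jArr {σ H : ℝ} (hσ : 0 < σ) (hH : 1 / 2 < H) (hH1 : H < 1) (m : ℕ) :
    Tendsto (fun n : ℕ => jArr σ H (n + m + 2) n) atTop
      (𝓝 (2 * gconst σ H * rho H (m + 1))) := by
  refine (tendsto_jcoef hσ hH hH1 (Nat.succ_le_succ (Nat.zero_le m))).congr fun n => ?_
  rw [jArr, if_pos (by omega)]
  congr 1
  omega

/-- The aim is to extract the decay `m ^ (-(1 - H))` and keep the exponent `3 / 2 - a = 2 - H > 1`,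
which is summable. Subadditivity of `t ↦ t ^ (2 * a)` separates `i` and `m`; the remaining mixed
term has total exponent `-(3 / 2 - a)` and is dominated by that power of the smaller variable. -/
theorem sq_kernel_le {a i m : ℝ} (ha : 0 < a) (ha1 : a < 1 / 2) (hi : 0 < i) (hm : 0 < m) :
    ((i + m) ^ a * m ^ (a - 1) * i ^ (-a)) ^ 2 ≤
      m ^ (-(1 / 2 - a)) * (2 * m ^ (-(3 / 2 - a)) + i ^ (-(3 / 2 - a))) := by
  have hsq : ∀ {x : ℝ}, 0 ≤ x → ∀ p : ℝ, (x ^ p) ^ 2 = x ^ (2 * p) := by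
    intro x hx p
    rw [mul_comm, Real.rpow_mul hx, Real.rpow_two]
  have h1 : (i + m) ^ (2 * a) ≤ i ^ (2 * a) + m ^ (2 * a) :=
    Real.rpow_add_le_add_rpow hi.le hm.le (by linarith) (by linarith)
  have h2 : m ^ (-(3 / 2 - 3 * a)) * i ^ (-(2 * a)) ≤ m ^ (-(3 / 2 - a)) + i ^ (-(3 / 2 - a)) := by
    rcases le_total i m with h | h
    · have : m ^ (-(3 / 2 - 3 * a)) ≤ i ^ (-(3 / 2 - 3 * a)) :=
        Real.rpow_le_rpow_of_nonpos hi h (by linarith)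
      calc m ^ (-(3 / 2 - 3 * a)) * i ^ (-(2 * a))
          ≤ i ^ (-(3 / 2 - 3 * a)) * i ^ (-(2 * a)) := by gcongr
        _ = i ^ (-(3 / 2 - a)) := by rw [← Real.rpow_add hi]; ring_nf
        _ ≤ _ := le_add_of_nonneg_left (Real.rpow_nonneg hm.le _)
    · have : i ^ (-(2 * a)) ≤ m ^ (-(2 * a)) :=
        Real.rpow_le_rpow_of_nonpos hm h (by linarith)
      calc m ^ (-(3 / 2 - 3 * a)) * i ^ (-(2 * a))
          ≤ m ^ (-(3 / 2 - 3 * a)) * m ^ (-(2 * a)) := by gcongr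
        _ = m ^ (-(3 / 2 - a)) := by rw [← Real.rpow_add hm]; ring_nf
        _ ≤ _ := le_add_of_nonneg_right (Real.rpow_nonneg hi.le _)
  calc ((i + m) ^ a * m ^ (a - 1) * i ^ (-a)) ^ 2
      = (i + m) ^ (2 * a) * m ^ (2 * (a - 1)) * i ^ (2 * -a) := by
        rw [mul_pow, mul_pow, hsq (by linarith), hsq hm.le, hsq hi.le]
    _ ≤ (i ^ (2 * a) + m ^ (2 * a)) * m ^ (2 * (a - 1)) * i ^ (2 * -a) := by gcongr
    _ = m ^ (2 * (a - 1)) * (i ^ (2 * a) * i ^ (2 * -a)) +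
        (m ^ (2 * a) * m ^ (2 * (a - 1))) * i ^ (2 * -a) := by ring
    _ = m ^ (-(1 / 2 - a)) * (m ^ (-(3 / 2 - a)) + m ^ (-(3 / 2 - 3 * a)) * i ^ (-(2 * a))) := by
        rw [← Real.rpow_add hi, ← Real.rpow_add hm, mul_add, ← mul_assoc, ← Real.rpow_add hm,
          ← Real.rpow_add hm, show 2 * a + 2 * -a = 0 by ring, Real.rpow_zero, mul_one]
        ring_nf
    _ ≤ _ := by
        refine mul_le_mul_of_nonneg_left ?_ (Real.rpow_nonneg hm.le _)
        linarith

theorem jArr_sq_le {σ H : ℝ} (hσ : 0 < σ) (hH : 1 / 2 < H) (hH1 : H < 1) {n i M : ℕ}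
    (hM : 2 ≤ M) (hn : i + 1 + M ≤ n) : jArr σ H n i ^ 2 ≤
      16 * (σ * CH H) ^ 2 * (M : ℝ) ^ (-(1 - H)) *
        (2 * ((n - 1 - i : ℕ) : ℝ) ^ (-(2 - H)) + ((i + 1 : ℕ) : ℝ) ^ (-(2 - H))) := by
  obtain ⟨m, hm⟩ : ∃ m, n = i + 1 + m := ⟨n - (i + 1), by omega⟩
  have hMm : M ≤ m := by omega
  have hm2 : (2 : ℝ) ≤ m := by exact_mod_cast hM.trans hMm
  have hi0 : (0 : ℝ) < ((i + 1 : ℕ) : ℝ) := by positivity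
  have hi1 : (1 : ℝ) ≤ ((i + 1 : ℕ) : ℝ) := by push_cast; linarith [(Nat.cast_nonneg i : (0 : ℝ) ≤ i)]
  have hm0 : (0 : ℝ) < m := by linarith
  have hK := mul_CH_pos hσ hH hH1
  have hnm : n - 1 - i = m := by omega
  have h0 : 0 ≤ jcoef σ H n (i + 1) := jcoef_nonneg hσ hH hH1 (by omega) (by omega)
  have h1 : jcoef σ H n (i + 1) ≤ σ * CH H * (4 * ((((i + 1 : ℕ) : ℝ) + m) ^ (H - 1 / 2) *
      (m : ℝ) ^ (H - 1 / 2 - 1) * ((i + 1 : ℕ) : ℝ) ^ (-(H - 1 / 2)))) := by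
    rw [jcoef_eq]
    refine mul_le_mul_of_nonneg_left ?_ hK.le
    have h := integral_jOuter_le_rpow (a := H - 1 / 2) (n := (n : ℝ)) (i := ((i + 1 : ℕ) : ℝ))
      (by linarith) (by linarith) hi1 (by rw [hm]; push_cast; linarith)
    refine h.trans (le_of_eq ?_)
    rw [hm, Nat.cast_add (i + 1) m, add_sub_cancel_left]
  have h2 := sq_kernel_le (a := H - 1 / 2) (by linarith) (by linarith) hi0 hm0
  rw [show 1 / 2 - (H - 1 / 2) = 1 - H by ring, show 3 / 2 - (H - 1 / 2) = 2 - H by ring] at h2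
  rw [jArr, if_pos (by omega), hnm]
  have h3 : (m : ℝ) ^ (-(1 - H)) ≤ (M : ℝ) ^ (-(1 - H)) :=
    Real.rpow_le_rpow_of_nonpos (by positivity) (by exact_mod_cast hMm) (by linarith)
  calc jcoef σ H n (i + 1) ^ 2 ≤ (σ * CH H * (4 * ((((i + 1 : ℕ) : ℝ) + m) ^ (H - 1 / 2) *
      (m : ℝ) ^ (H - 1 / 2 - 1) * ((i + 1 : ℕ) : ℝ) ^ (-(H - 1 / 2))))) ^ 2 :=
        pow_le_pow_left₀ h0 h1 2
    _ = 16 * (σ * CH H) ^ 2 * ((((i + 1 : ℕ) : ℝ) + m) ^ (H - 1 / 2) *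
      (m : ℝ) ^ (H - 1 / 2 - 1) * ((i + 1 : ℕ) : ℝ) ^ (-(H - 1 / 2))) ^ 2 := by ring
    _ ≤ 16 * (σ * CH H) ^ 2 * ((M : ℝ) ^ (-(1 - H)) *
        (2 * (m : ℝ) ^ (-(2 - H)) + ((i + 1 : ℕ) : ℝ) ^ (-(2 - H)))) := by
        refine mul_le_mul_of_nonneg_left (h2.trans ?_) (by positivity)
        exact mul_le_mul_of_nonneg_right h3 (by positivity)
    _ = _ := by ring

theorem exists_tail_bound_of_two_le {σ H : ℝ} (hσ : 0 < σ) (hH : 1 / 2 < H) (hH1 : H < 1) :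
    ∃ W : ℝ, 0 ≤ W ∧ ∀ n M : ℕ, 2 ≤ M →
      ∑ i ∈ Finset.range (n - M), jArr σ H n i ^ 2 ≤ W * (M : ℝ) ^ (-(1 - H)) := by
  have hs : Summable fun k : ℕ => (k : ℝ) ^ (-(2 - H)) :=
    Real.summable_nat_rpow.2 (by linarith)
  have hpos : ∀ k : ℕ, 0 ≤ (k : ℝ) ^ (-(2 - H)) := fun k => by positivity
  set Z := ∑' k : ℕ, (k : ℝ) ^ (-(2 - H)) with hZ
  have hZ0 : 0 ≤ Z := tsum_nonneg hpos
  refine ⟨16 * (σ * CH H) ^ 2 * (3 * Z), by positivity, fun n M hM => ?_⟩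
  have h1 : ∑ i ∈ Finset.range (n - M), ((n - 1 - i : ℕ) : ℝ) ^ (-(2 - H)) ≤ Z :=
    calc ∑ i ∈ Finset.range (n - M), ((n - 1 - i : ℕ) : ℝ) ^ (-(2 - H))
        ≤ ∑ i ∈ Finset.range n, ((n - 1 - i : ℕ) : ℝ) ^ (-(2 - H)) :=
          Finset.sum_le_sum_of_subset_of_nonneg (Finset.range_subset_range.2 (Nat.sub_le n M))
            fun i _ _ => hpos _
      _ = ∑ i ∈ Finset.range n, (i : ℝ) ^ (-(2 - H)) :=
          Finset.sum_range_reflect (fun i : ℕ => (i : ℝ) ^ (-(2 - H))) n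
      _ ≤ Z := hs.sum_le_tsum _ fun i _ => hpos i
  have h2 : ∑ i ∈ Finset.range (n - M), ((i + 1 : ℕ) : ℝ) ^ (-(2 - H)) ≤ Z := by
    refine le_trans ?_ (hs.sum_le_tsum (Finset.range (n - M + 1)) fun i _ => hpos i)
    rw [Finset.sum_range_succ']
    exact le_add_of_nonneg_right (hpos 0)
  calc ∑ i ∈ Finset.range (n - M), jArr σ H n i ^ 2
      ≤ ∑ i ∈ Finset.range (n - M), 16 * (σ * CH H) ^ 2 * (M : ℝ) ^ (-(1 - H)) *
        (2 * ((n - 1 - i : ℕ) : ℝ) ^ (-(2 - H)) + ((i + 1 : ℕ) : ℝ) ^ (-(2 - H))) := by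
        refine Finset.sum_le_sum fun i hi => jArr_sq_le hσ hH hH1 hM ?_
        have := Finset.mem_range.1 hi
        omega
    _ = 16 * (σ * CH H) ^ 2 * (M : ℝ) ^ (-(1 - H)) *
        (2 * ∑ i ∈ Finset.range (n - M), ((n - 1 - i : ℕ) : ℝ) ^ (-(2 - H)) +
          ∑ i ∈ Finset.range (n - M), ((i + 1 : ℕ) : ℝ) ^ (-(2 - H))) := by
        rw [← Finset.mul_sum, Finset.sum_add_distrib, ← Finset.mul_sum]
    _ ≤ 16 * (σ * CH H) ^ 2 * (M : ℝ) ^ (-(1 - H)) * (3 * Z) := by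
        refine mul_le_mul_of_nonneg_left (by linarith) (by positivity)
    _ = _ := by ring

/-- Uniform square summability of the coefficients. -/
theorem exists_tail_bound {σ H : ℝ} (hσ : 0 < σ) (hH : 1 / 2 < H) (hH1 : H < 1) :
    ∃ τ : ℕ → ℝ, Tendsto τ atTop (𝓝 0) ∧ ∀ n M : ℕ,
      ∑ i ∈ Finset.range (n - M), jArr σ H n i ^ 2 ≤ τ M := by
  obtain ⟨W, hW0, hW⟩ := exists_tail_bound_of_two_le hσ hH hH1
  obtain ⟨B, hB⟩ := ((tendsto_jArr hσ hH hH1 0).pow 2).bddAbove_range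
  have hB' : ∀ n, jArr σ H (n + 2) n ^ 2 ≤ B := fun n => hB ⟨n, rfl⟩
  -- The power bound needs lag at least 2. For `M < 2` the only further nonzero entry is the one at
  -- lag 1, and `B` bounds its square because it converges.
  refine ⟨fun M => if M < 2 then W * ((2 : ℕ) : ℝ) ^ (-(1 - H)) + B else W * (M : ℝ) ^ (-(1 - H)),
    ?_, fun n M => ?_⟩
  · have h1 : Tendsto (fun M : ℕ => W * (M : ℝ) ^ (-(1 - H))) atTop (𝓝 0) := by
      have := ((tendsto_rpow_neg_atTop (show 0 < 1 - H by linarith)).comp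
        tendsto_natCast_atTop_atTop).const_mul W
      simpa using this
    refine h1.congr' ?_
    filter_upwards [eventually_ge_atTop 2] with M hM
    rw [if_neg (by omega)]
  · dsimp only
    split_ifs with hM
    · have h0 : 0 ≤ W * ((2 : ℕ) : ℝ) ^ (-(1 - H)) := by positivity
      refine (Finset.sum_le_sum_of_subset_of_nonneg
        (Finset.range_subset_range.2 (Nat.sub_le n M)) fun i _ _ => sq_nonneg _).trans ?_
      rcases lt_or_ge n 2 with hn | hn
      · rw [Finset.sum_eq_zero fun i hi => ?_]
        · linarith [(sq_nonneg _).trans (hB' 0)]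
        · rw [jArr_of_le (by omega)]; simp
      · obtain ⟨k, rfl⟩ := Nat.exists_eq_add_of_le' hn
        rw [Finset.sum_range_succ, Finset.sum_range_succ, jArr_of_le (i := k + 1) (by omega)]
        have := hW (k + 2) 2 le_rfl
        rw [Nat.add_sub_cancel] at this
        linarith [hB' k]
    · exact hW n M (by omega)

/-! ### Arrays with uniformly small tails. -/

/-- A lower triangular array which is uniformly square summable away from the diagonal and converges
along the diagonals. -/
structure IsTailArray (c : ℕ → ℕ → ℝ) (τ ℓ : ℕ → ℝ) : Prop where
  zero : ∀ n i, n ≤ i + 1 → c n i = 0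
  tendsto_tail : Tendsto τ atTop (𝓝 0)
  sum_sq_le : ∀ n M, ∑ i ∈ Finset.range (n - M), c n i ^ 2 ≤ τ M
  tendsto_diag : ∀ m, Tendsto (fun n => c (n + m + 2) n) atTop (𝓝 (ℓ m))

namespace IsTailArray

variable {c : ℕ → ℕ → ℝ} {τ ℓ : ℕ → ℝ}

theorem tail_nonneg (h : IsTailArray c τ ℓ) (M : ℕ) : 0 ≤ τ M := by
  simpa using h.sum_sq_le 0 M

theorem sum_range_sq_le (h : IsTailArray c τ ℓ) (N n : ℕ) :
    ∑ i ∈ Finset.range N, c n i ^ 2 ≤ τ 0 := by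
  refine le_trans ?_ (h.sum_sq_le n 0)
  have h1 : ∑ i ∈ Finset.range N, c n i ^ 2 =
      ∑ i ∈ (Finset.range N).filter (· < n), c n i ^ 2 := by
    rw [Finset.sum_filter_of_ne]
    intro i _ hi
    by_contra hin
    exact hi (by rw [h.zero n i (by omega)]; simp)
  rw [h1]
  refine Finset.sum_le_sum_of_subset_of_nonneg (fun i hi => ?_) fun i _ _ => sq_nonneg _
  simpa using (Finset.mem_filter.1 hi).2

/-- Row `n` lives on columns below `n`, which in row `n'` belong to the tail at distance `n' - n`.
Cauchy-Schwarz then gives decay in the gap. -/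
theorem sq_sum_mul_le_of_le (h : IsTailArray c τ ℓ) (N : ℕ) {n n' : ℕ} (hn : n ≤ n') :
    (∑ i ∈ Finset.range N, c n i * c n' i) ^ 2 ≤ τ 0 * τ (n' - n) := by
  have h1 : ∑ i ∈ Finset.range N, c n i * c n' i =
      ∑ i ∈ (Finset.range N).filter (· < n), c n i * c n' i := by
    rw [Finset.sum_filter_of_ne]
    intro i _ hi
    by_contra hin
    exact hi (by rw [h.zero n i (by omega)]; simp)
  rw [h1]
  refine (Finset.sum_mul_sq_le_sq_mul_sq _ _ _).trans (mul_le_mul ?_ ?_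
    (Finset.sum_nonneg fun i _ => sq_nonneg _) (h.tail_nonneg 0))
  · refine le_trans ?_ (h.sum_sq_le n 0)
    refine Finset.sum_le_sum_of_subset_of_nonneg (fun i hi => ?_) fun i _ _ => sq_nonneg _
    simpa using (Finset.mem_filter.1 hi).2
  · refine le_trans ?_ (h.sum_sq_le n' (n' - n))
    refine Finset.sum_le_sum_of_subset_of_nonneg (fun i hi => ?_) fun i _ _ => sq_nonneg _
    have := (Finset.mem_filter.1 hi).2
    rw [Finset.mem_range]
    omega

theorem sq_sum_mul_le (h : IsTailArray c τ ℓ) (N n n' : ℕ) :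
    (∑ i ∈ Finset.range N, c n i * c n' i) ^ 2 ≤ τ 0 * τ (max n n' - min n n') := by
  rcases le_total n n' with hn | hn
  · rw [max_eq_right hn, min_eq_left hn]
    exact h.sq_sum_mul_le_of_le N hn
  · rw [max_eq_left hn, min_eq_right hn]
    simp_rw [mul_comm (c n _)]
    exact h.sq_sum_mul_le_of_le N hn

theorem sq_sum_abs_le (h : IsTailArray c τ ℓ) (n : ℕ) :
    (∑ i ∈ Finset.range n, |c n i|) ^ 2 ≤ n * τ 0 := by
  have h1 := sq_sum_le_card_mul_sum_sq (s := Finset.range n) (f := fun i => |c n i|)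
  simp only [sq_abs, Finset.card_range] at h1
  exact h1.trans (mul_le_mul_of_nonneg_left (h.sum_range_sq_le n n) (Nat.cast_nonneg n))

/-- Any finitely many diagonal limits are simultaneous limits of entries of a single row, whose
square sum is at most `τ 0`. -/
theorem summable_sq (h : IsTailArray c τ ℓ) : Summable fun m => ℓ m ^ 2 := by
  refine summable_of_sum_range_le (c := τ 0) (fun m => sq_nonneg _) fun M => ?_
  have h1 : Tendsto (fun n => ∑ m ∈ Finset.range M, c (n + M + 1) (n + (M - 1 - m)) ^ 2) atTop
      (𝓝 (∑ m ∈ Finset.range M, ℓ m ^ 2)) := by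
    refine tendsto_finsetSum _ fun m hm => ?_
    have hm' := Finset.mem_range.1 hm
    refine (((h.tendsto_diag m).comp (tendsto_add_atTop_nat (M - 1 - m))).pow 2).congr fun n => ?_
    simp only [Function.comp_apply]
    congr 2
    omega
  refine le_of_tendsto h1 (Eventually.of_forall fun n => ?_)
  rw [Finset.sum_range_reflect (fun m => c (n + M + 1) (n + m) ^ 2) M]
  refine le_trans ?_ (h.sum_range_sq_le (n + M) (n + M + 1))
  rw [Finset.sum_range_add]
  exact le_add_of_nonneg_left (Finset.sum_nonneg fun i _ => sq_nonneg _)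

theorem summable_mul (h : IsTailArray c τ ℓ) : Summable fun m => ℓ m * ℓ (m + 1) := by
  have h1 := h.summable_sq
  have h2 := (summable_nat_add_iff 1).2 h1
  refine Summable.of_norm_bounded (h1.add h2) fun m => ?_
  rw [Real.norm_eq_abs, abs_mul]
  nlinarith [sq_nonneg (|ℓ m| - |ℓ (m + 1)|), sq_abs (ℓ m), sq_abs (ℓ (m + 1)),
    sq_nonneg (ℓ m), sq_nonneg (ℓ (m + 1))]

end IsTailArray

theorem tendsto_of_uniform_approx {D : ℕ → ℝ} {f : ℕ → ℕ → ℝ} {F : ℕ → ℝ} {L : ℝ} {ε : ℕ → ℝ}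
    (hε : Tendsto ε atTop (𝓝 0)) (hD : ∀ M, ∀ᶠ n in atTop, |D n - f M n| ≤ ε M)
    (hf : ∀ M, Tendsto (f M) atTop (𝓝 (F M))) (hF : Tendsto F atTop (𝓝 L)) :
    Tendsto D atTop (𝓝 L) := by
  rw [Metric.tendsto_atTop]
  intro δ hδ
  have h1 := hε.eventually_lt_const (show (0 : ℝ) < δ / 3 by positivity)
  have h2 := (Metric.tendsto_nhds.1 hF) (δ / 3) (by positivity)
  obtain ⟨M, hM1, hM2⟩ := (h1.and h2).exists
  have h3 := (Metric.tendsto_nhds.1 (hf M)) (δ / 3) (by positivity)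
  obtain ⟨N, hN⟩ := eventually_atTop.1 ((hD M).and h3)
  refine ⟨N, fun n hn => ?_⟩
  obtain ⟨h4, h5⟩ := hN n hn
  have h6 := dist_triangle4 (D n) (f M n) (F M) L
  rw [Real.dist_eq (D n) (f M n)] at h6
  linarith

namespace IsTailArray

variable {c : ℕ → ℕ → ℝ} {τ ℓ : ℕ → ℝ}

/-- Convergence of the covariances of consecutive rows. -/
theorem tendsto_sum_mul (h : IsTailArray c τ ℓ) :
    Tendsto (fun p => ∑ i ∈ Finset.range p, c p i * c (p + 1) i) atTop
      (𝓝 (∑' m, ℓ m * ℓ (m + 1))) := by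
  rw [← tendsto_add_atTop_iff_nat 1]
  have hε : Tendsto (fun M => τ (M + 1) + τ (M + 2)) atTop (𝓝 0) := by
    simpa using ((tendsto_add_atTop_iff_nat 1).2 h.tendsto_tail).add
      ((tendsto_add_atTop_iff_nat 2).2 h.tendsto_tail)
  -- `f M` keeps the `M` nontrivial entries nearest the diagonal. The discarded columns lie in the
  -- tails `M + 1` and `M + 2` of the two rows, and `|x * y| ≤ x ^ 2 + y ^ 2`.
  refine tendsto_of_uniform_approx (f := fun M n => ∑ m ∈ Finset.range M,
    c (n + 1) (n - 1 - m) * c (n + 1 + 1) (n - 1 - m))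
    (F := fun M => ∑ m ∈ Finset.range M, ℓ m * ℓ (m + 1)) hε (fun M => ?_) (fun M => ?_)
    h.summable_mul.hasSum.tendsto_sum_nat
  · filter_upwards [eventually_ge_atTop M] with n hn
    obtain ⟨k, rfl⟩ := Nat.exists_eq_add_of_le' hn
    have h1 : ∑ m ∈ Finset.range M,
        c (k + M + 1) (k + M - 1 - m) * c (k + M + 1 + 1) (k + M - 1 - m) =
        ∑ m ∈ Finset.range M, c (k + M + 1) (k + m) * c (k + M + 1 + 1) (k + m) := by
      rw [← Finset.sum_range_reflect]
      refine Finset.sum_congr rfl fun m hm => ?_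
      have := Finset.mem_range.1 hm
      rw [show k + M - 1 - (M - 1 - m) = k + m by omega]
    rw [h1, Finset.sum_range_succ, h.zero (k + M + 1) (k + M) le_rfl, zero_mul, add_zero,
      Finset.sum_range_add, add_sub_cancel_right]
    have h2 := h.sum_sq_le (k + M + 1) (M + 1)
    have h3 := h.sum_sq_le (k + M + 1 + 1) (M + 2)
    rw [show k + M + 1 - (M + 1) = k by omega] at h2
    rw [show k + M + 1 + 1 - (M + 2) = k by omega] at h3
    refine (Finset.abs_sum_le_sum_abs _ _).trans (le_trans ?_ (add_le_add h2 h3))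
    rw [← Finset.sum_add_distrib]
    refine Finset.sum_le_sum fun i _ => ?_
    rw [abs_le]
    constructor <;> nlinarith [sq_nonneg (c (k + M + 1) i - c (k + M + 1 + 1) i),
      sq_nonneg (c (k + M + 1) i + c (k + M + 1 + 1) i), sq_nonneg (c (k + M + 1) i),
      sq_nonneg (c (k + M + 1 + 1) i)]
  · refine tendsto_finsetSum _ fun m _ => ?_
    rw [← tendsto_add_atTop_iff_nat (m + 1)]
    refine ((h.tendsto_diag m).mul (h.tendsto_diag (m + 1))).congr fun n => ?_
    rw [show n + (m + 1) - 1 - m = n by omega]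
    rfl

/-- The argument of `τ` is `|p - q|`, and each positive gap is attained by at most `2 * N` pairs. -/
theorem sum_sum_max_sub_min_le (hτ : ∀ M, 0 ≤ τ M) (N : ℕ) :
    ∑ p ∈ Finset.range N, ∑ q ∈ Finset.range N, τ (max p q - min p q) ≤
      N * τ 0 + 2 * N * ∑ d ∈ Finset.range N, τ (d + 1) := by
  rw [sum_range_sum_range_eq]
  have h1 : ∑ i ∈ Finset.range N, τ (max i i - min i i) = N * τ 0 := by simp
  rw [h1]
  have h2 : ∀ l ∈ Finset.range N, ∑ i ∈ Finset.range l,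
      (τ (max i l - min i l) + τ (max l i - min l i)) ≤
        2 * ∑ d ∈ Finset.range N, τ (d + 1) := by
    intro l hl
    have h3 : ∑ i ∈ Finset.range l, (τ (max i l - min i l) + τ (max l i - min l i)) =
        2 * ∑ i ∈ Finset.range l, τ (i + 1) := by
      rw [← Finset.sum_range_reflect (fun i => τ (i + 1)), Finset.mul_sum]
      refine Finset.sum_congr rfl fun i hi => ?_
      have := Finset.mem_range.1 hi
      rw [show max i l - min i l = l - 1 - i + 1 by omega,
        show max l i - min l i = l - 1 - i + 1 by omega]
      ring
    rw [h3]
    refine mul_le_mul_of_nonneg_left (Finset.sum_le_sum_of_subset_of_nonneg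
      (Finset.range_subset_range.2 (Finset.mem_range.1 hl).le) fun i _ _ => hτ _) (by norm_num)
  have h4 := Finset.sum_le_sum h2
  rw [Finset.sum_const, Finset.card_range, nsmul_eq_mul] at h4
  linarith

/-- The squared Hilbert-Schmidt norm of `∑ p, c p ⊗ c (p + 1)` is `o(N ^ 2)`. -/
theorem tendsto_hilbertSchmidt (h : IsTailArray c τ ℓ) :
    Tendsto (fun N : ℕ => 1 / (N : ℝ) ^ 2 * ∑ i ∈ Finset.range N, ∑ l ∈ Finset.range N,
      (∑ p ∈ Finset.range N, c p i * c (p + 1) l) ^ 2) atTop (𝓝 0) := by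
  have hb : ∀ N : ℕ, ∑ i ∈ Finset.range N, ∑ l ∈ Finset.range N,
      (∑ p ∈ Finset.range N, c p i * c (p + 1) l) ^ 2 ≤
        τ 0 * (N * τ 0 + 2 * N * ∑ d ∈ Finset.range N, τ (d + 1)) := by
    intro N
    -- Expanding the square turns the norm into a sum over pairs of rows of products of two
    -- covariances, both at gap `|p - q|`; each product is at most `τ 0 * τ |p - q|`.
    have h1 : ∑ i ∈ Finset.range N, ∑ l ∈ Finset.range N,
        (∑ p ∈ Finset.range N, c p i * c (p + 1) l) ^ 2 =
        ∑ p ∈ Finset.range N, ∑ q ∈ Finset.range N,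
          (∑ i ∈ Finset.range N, c p i * c q i) *
            (∑ l ∈ Finset.range N, c (p + 1) l * c (q + 1) l) := by
      simp_rw [sq, Finset.sum_mul_sum]
      calc _ = ∑ i ∈ Finset.range N, ∑ p ∈ Finset.range N, ∑ l ∈ Finset.range N,
            ∑ q ∈ Finset.range N, c p i * c (p + 1) l * (c q i * c (q + 1) l) :=
            Finset.sum_congr rfl fun i _ => Finset.sum_comm
        _ = ∑ p ∈ Finset.range N, ∑ i ∈ Finset.range N, ∑ l ∈ Finset.range N,
            ∑ q ∈ Finset.range N, c p i * c (p + 1) l * (c q i * c (q + 1) l) :=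
            Finset.sum_comm
        _ = ∑ p ∈ Finset.range N, ∑ i ∈ Finset.range N, ∑ q ∈ Finset.range N,
            ∑ l ∈ Finset.range N, c p i * c (p + 1) l * (c q i * c (q + 1) l) :=
            Finset.sum_congr rfl fun p _ => Finset.sum_congr rfl fun i _ => Finset.sum_comm
        _ = ∑ p ∈ Finset.range N, ∑ q ∈ Finset.range N, ∑ i ∈ Finset.range N,
            ∑ l ∈ Finset.range N, c p i * c (p + 1) l * (c q i * c (q + 1) l) :=
            Finset.sum_congr rfl fun p _ => Finset.sum_comm
        _ = _ := by
            refine Finset.sum_congr rfl fun p _ => Finset.sum_congr rfl fun q _ =>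
              Finset.sum_congr rfl fun i _ => Finset.sum_congr rfl fun l _ => ?_
            ring
    rw [h1]
    refine le_trans ?_ (mul_le_mul_of_nonneg_left (sum_sum_max_sub_min_le h.tail_nonneg N)
      (h.tail_nonneg 0))
    rw [Finset.mul_sum]
    refine Finset.sum_le_sum fun p _ => ?_
    rw [Finset.mul_sum]
    refine Finset.sum_le_sum fun q _ => ?_
    have h2 := h.sq_sum_mul_le N p q
    have h3 := h.sq_sum_mul_le N (p + 1) (q + 1)
    rw [show max (p + 1) (q + 1) - min (p + 1) (q + 1) = max p q - min p q by omega] at h3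
    nlinarith [sq_nonneg ((∑ i ∈ Finset.range N, c p i * c q i) -
      ∑ l ∈ Finset.range N, c (p + 1) l * c (q + 1) l)]
  -- After division by `N ^ 2` the bound is governed by a Cesàro mean of `τ`, which tends to zero.
  have hces : Tendsto (fun N : ℕ => τ 0 * (τ 0 * (1 / (N : ℝ)) +
      2 * ((N : ℝ)⁻¹ * ∑ d ∈ Finset.range N, τ (d + 1)))) atTop (𝓝 0) := by
    have h1 := ((tendsto_add_atTop_iff_nat 1).2 h.tendsto_tail).cesaro
    have h2 := tendsto_one_div_atTop_nhds_zero_nat (𝕜 := ℝ)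
    simpa using ((h2.const_mul (τ 0)).add (h1.const_mul 2)).const_mul (τ 0)
  refine tendsto_of_tendsto_of_tendsto_of_le_of_le tendsto_const_nhds hces (fun N => ?_)
    fun N => ?_
  · positivity
  · refine (mul_le_mul_of_nonneg_left (hb N) (by positivity)).trans (le_of_eq ?_)
    rcases eq_or_ne N 0 with rfl | hN
    · simp
    · have : (N : ℝ) ≠ 0 := by exact_mod_cast hN
      field_simp

end IsTailArray

theorem tendsto_one_div_sq_mul_of_le {u : ℕ → ℝ} {C : ℝ} (h0 : ∀ N, 0 ≤ u N)
    (h : ∀ N : ℕ, u N ≤ C * N) :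
    Tendsto (fun N : ℕ => 1 / (N : ℝ) ^ 2 * u N) atTop (𝓝 0) := by
  have h2 : Tendsto (fun N : ℕ => C * (1 / (N : ℝ))) atTop (𝓝 0) := by
    simpa using (tendsto_one_div_atTop_nhds_zero_nat (𝕜 := ℝ)).const_mul C
  refine tendsto_of_tendsto_of_tendsto_of_le_of_le tendsto_const_nhds h2 (fun N => ?_)
    fun N => ?_
  · exact mul_nonneg (by positivity) (h0 N)
  · refine (mul_le_mul_of_nonneg_left (h N) (by positivity)).trans (le_of_eq ?_)
    rcases eq_or_ne N 0 with rfl | hN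
    · simp
    · have : (N : ℝ) ≠ 0 := by exact_mod_cast hN
      field_simp

/-! ### The value process and the four sums as quadratic forms. -/

theorem sum_Icc_one_eq (f : ℕ → ℝ) (N : ℕ) :
    ∑ k ∈ Finset.Icc 1 N, f k = ∑ p ∈ Finset.range N, f (p + 1) := by
  induction N with
  | zero => simp
  | succ n ih => rw [Finset.sum_Icc_succ_top (by omega), ih, Finset.sum_range_succ]

/-- Used for `S1` and `S3`, whose first summand vanishes as `g_0 = 0`. The cutoff keeps the range
equal to `N`, so that all four forms live on the same index square. -/
theorem sum_range_eq_sum_shift {f : ℕ → ℝ} (h0 : f 0 = 0) (N : ℕ) :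
    ∑ p ∈ Finset.range N, f p = ∑ q ∈ Finset.range N, if q + 1 < N then f (q + 1) else 0 := by
  cases N with
  | zero => simp
  | succ n =>
    rw [Finset.sum_range_succ', h0, add_zero, Finset.sum_range_succ, if_neg (by omega), add_zero]
    refine Finset.sum_congr rfl fun q hq => ?_
    have := Finset.mem_range.1 hq
    rw [if_pos (by omega)]

section Algebra

variable {Ω : Type*}

theorem gcoef_zero (σ H : ℝ) : gcoef σ H 0 = 0 := if_pos rfl

theorem X_zero (σ H : ℝ) (ξ : ℕ → Ω → ℝ) (ω : Ω) : X σ H ξ 0 ω = 0 := by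
  simp [X, Y, gcoef_zero]

theorem sum_X_mul_X (σ H : ℝ) (ξ : ℕ → Ω → ℝ) (n : ℕ) (ω : Ω) :
    ∑ k ∈ Finset.Icc 1 n, X σ H ξ (k - 1) ω * X σ H ξ k ω =
      S1 σ H ξ n ω + S2 σ H ξ n ω + S3 σ H ξ n ω + S4 σ H ξ n ω := by
  simp only [S1, S2, S3, S4, ← Finset.sum_add_distrib]
  refine Finset.sum_congr rfl fun k _ => ?_
  simp only [X]
  ring

/-- Summation by parts: a self-financing value is the accumulated trading gain. -/
theorem portfolioValue_eq {φ S : ℕ → ℝ} (h0 : φ 0 = 0) (n : ℕ) :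
    portfolioValue φ S n = ∑ k ∈ Finset.range n, φ k * (S (k + 1) - S k) := by
  simp only [portfolioValue, bondPosition, sum_Icc_one_eq, Nat.add_sub_cancel, h0]
  induction n with
  | zero => simp [h0]
  | succ n ih =>
    rw [Finset.sum_range_succ, Finset.sum_range_succ, ← ih]
    ring

/-- The price increment is `X_{k+1} N^{-H} S_k`, so the position `N^{H-1} X_k / S_k` gains `X_k
X_{k+1} / N`; at `k = 0` both sides vanish because `X_0 = 0`. -/
theorem V_eq (σ H s₀ : ℝ) (ξ : ℕ → Ω → ℝ) {N : ℕ} (hN : 1 ≤ N) {ω : Ω}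
    (hS : ∀ n ≤ N, stock σ H s₀ ξ N n ω ≠ 0) {n : ℕ} (hn : n ≤ N) :
    V σ H s₀ ξ N n ω =
      1 / (N : ℝ) * ∑ k ∈ Finset.Icc 1 n, X σ H ξ (k - 1) ω * X σ H ξ k ω := by
  have hN0 : (0 : ℝ) < N := by exact_mod_cast hN
  rw [V, portfolioValue_eq (by simp [stockPosition]), sum_Icc_one_eq, Finset.mul_sum]
  refine Finset.sum_congr rfl fun k hk => ?_
  have hkN : k ≤ N := (Finset.mem_range.1 hk).le.trans hn
  have hSk := hS k hkN
  simp only [stock, Nat.add_sub_cancel]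
  rcases eq_or_ne k 0 with rfl | hk0
  · simp [stockPosition, X_zero]
  · have hNH : (N : ℝ) ^ H ≠ 0 := (Real.rpow_pos_of_pos hN0 H).ne'
    rw [stockPosition, if_neg hk0, Real.rpow_sub_one hN0.ne']
    field_simp
    ring

theorem stock_ne_zero {σ H s₀ : ℝ} (hs₀ : s₀ ≠ 0) {ξ : ℕ → Ω → ℝ} {N : ℕ} {ω : Ω}
    (h : ∀ n ≤ N, |X σ H ξ n ω| < (N : ℝ) ^ H) : ∀ n ≤ N, stock σ H s₀ ξ N n ω ≠ 0 := by
  intro n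
  induction n with
  | zero => exact fun _ => hs₀
  | succ n ih =>
    intro hn
    rw [stock]
    refine mul_ne_zero (fun h0 => ?_) (ih (by omega))
    have h1 := h (n + 1) hn
    have hpos : 0 < (N : ℝ) ^ H := (abs_nonneg _).trans_lt h1
    have h2 : X σ H ξ (n + 1) ω = -(N : ℝ) ^ H := by
      field_simp at h0
      linarith
    rw [h2, abs_neg, abs_of_pos hpos] at h1
    exact lt_irrefl _ h1

theorem Y_eq_sum_range (σ H : ℝ) (ξ : ℕ → Ω → ℝ) {n N : ℕ} (h : n ≤ N + 1) (ω : Ω) :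
    Y σ H ξ n ω = ∑ i ∈ Finset.range N, jArr σ H n i * ξ (i + 1) ω := by
  rw [Y, Finset.sum_Ico_eq_sum_range]
  have h1 : ∑ i ∈ Finset.range N, jArr σ H n i * ξ (i + 1) ω =
      ∑ i ∈ Finset.range (n - 1), jArr σ H n i * ξ (i + 1) ω := by
    symm
    refine Finset.sum_subset (Finset.range_subset_range.2 (by omega)) fun i _ hi => ?_
    rw [jArr_of_le, zero_mul]
    rw [Finset.mem_range] at hi
    omega
  rw [h1]
  refine Finset.sum_congr rfl fun i hi => ?_
  have := Finset.mem_range.1 hi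
  rw [jArr, if_pos (by omega), add_comm 1 i]

theorem S1_eq_quadForm (σ H : ℝ) (ξ : ℕ → Ω → ℝ) (N : ℕ) (ω : Ω) :
    S1 σ H ξ N ω = ∑ i ∈ Finset.range N, ∑ l ∈ Finset.range N,
      (if l = i + 1 then gcoef σ H (i + 1) * gcoef σ H (l + 1) else 0) *
        (ξ (i + 1) ω * ξ (l + 1) ω) := by
  rw [S1, sum_Icc_one_eq, sum_range_eq_sum_shift (by simp [gcoef_zero])]
  refine Finset.sum_congr rfl fun i _ => ?_
  simp only [ite_mul, zero_mul, Finset.sum_ite_eq', Finset.mem_range, Nat.add_sub_cancel]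
  split_ifs
  · ring
  · rfl

theorem S2_eq_quadForm (σ H : ℝ) (ξ : ℕ → Ω → ℝ) (N : ℕ) (ω : Ω) :
    S2 σ H ξ N ω = ∑ i ∈ Finset.range N, ∑ l ∈ Finset.range N,
      (gcoef σ H (i + 1) * jArr σ H i l) * (ξ (i + 1) ω * ξ (l + 1) ω) := by
  rw [S2, sum_Icc_one_eq]
  refine Finset.sum_congr rfl fun i hi => ?_
  have := Finset.mem_range.1 hi
  rw [Nat.add_sub_cancel, Y_eq_sum_range (N := N) σ H ξ (by omega), Finset.mul_sum]
  refine Finset.sum_congr rfl fun l _ => ?_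
  ring

theorem S3_eq_quadForm (σ H : ℝ) (ξ : ℕ → Ω → ℝ) (N : ℕ) (ω : Ω) :
    S3 σ H ξ N ω = ∑ i ∈ Finset.range N, ∑ l ∈ Finset.range N,
      (if i + 1 < N then gcoef σ H (i + 1) * jArr σ H (i + 2) l else 0) *
        (ξ (i + 1) ω * ξ (l + 1) ω) := by
  rw [S3, sum_Icc_one_eq, sum_range_eq_sum_shift (by simp [gcoef_zero])]
  refine Finset.sum_congr rfl fun i _ => ?_
  split_ifs with h
  · rw [Nat.add_sub_cancel, Y_eq_sum_range (N := N) σ H ξ (by omega), Finset.mul_sum]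
    refine Finset.sum_congr rfl fun l _ => ?_
    ring
  · simp

theorem S4_eq_quadForm (σ H : ℝ) (ξ : ℕ → Ω → ℝ) (N : ℕ) (ω : Ω) :
    S4 σ H ξ N ω = ∑ i ∈ Finset.range N, ∑ l ∈ Finset.range N,
      (∑ p ∈ Finset.range N, jArr σ H p i * jArr σ H (p + 1) l) *
        (ξ (i + 1) ω * ξ (l + 1) ω) := by
  have h1 : S4 σ H ξ N ω = ∑ p ∈ Finset.range N, ∑ i ∈ Finset.range N, ∑ l ∈ Finset.range N,
      (jArr σ H p i * jArr σ H (p + 1) l) * (ξ (i + 1) ω * ξ (l + 1) ω) := by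
    rw [S4, sum_Icc_one_eq]
    refine Finset.sum_congr rfl fun p hp => ?_
    have := Finset.mem_range.1 hp
    rw [Nat.add_sub_cancel, Y_eq_sum_range (N := N) σ H ξ (by omega),
      Y_eq_sum_range (N := N) σ H ξ (by omega), Finset.sum_mul_sum]
    refine Finset.sum_congr rfl fun i _ => Finset.sum_congr rfl fun l _ => ?_
    ring
  rw [h1, Finset.sum_comm]
  refine Finset.sum_congr rfl fun i _ => ?_
  rw [Finset.sum_comm]
  exact Finset.sum_congr rfl fun l _ => (Finset.sum_mul _ _ _).symm

end Algebra

/-! ### Convergence of the four normalised sums. -/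

section Convergence

variable {Ω : Type*} [MeasurableSpace Ω] {P : Measure Ω} [IsProbabilityMeasure P]

theorem TendstoLp.add {p : ENNReal} (hp : 1 ≤ p) {f g : ℕ → Ω → ℝ} {b c : ℝ}
    (hf : TendstoLp P p f b) (hg : TendstoLp P p g c) :
    TendstoLp P p (fun N ω => f N ω + g N ω) (b + c) := by
  refine ⟨fun N => (hf.1 N).add (hg.1 N), ?_⟩
  have h := hf.2.add hg.2
  rw [add_zero] at h
  refine tendsto_of_tendsto_of_tendsto_of_le_of_le tendsto_const_nhds h (fun _ => zero_le)
    fun N => ?_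
  have h1 : (fun ω => f N ω + g N ω - (b + c)) =
      (fun ω => f N ω - b) + fun ω => g N ω - c := by
    ext ω
    simp only [Pi.add_apply]
    ring
  rw [h1]
  exact eLpNorm_add_le ((hf.1 N).sub (memLp_const b)).1 ((hg.1 N).sub (memLp_const c)).1 hp

theorem TendstoLp.mono_exponent {p q : ENNReal} (hpq : p ≤ q) {f : ℕ → Ω → ℝ} {c : ℝ}
    (hf : TendstoLp P q f c) : TendstoLp P p f c :=
  ⟨fun N => (hf.1 N).mono_exponent hpq,
    tendsto_of_tendsto_of_tendsto_of_le_of_le tendsto_const_nhds hf.2 (fun _ => zero_le)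
      fun N => eLpNorm_le_eLpNorm_of_exponent_le hpq ((hf.1 N).sub (memLp_const c)).1⟩

theorem TendstoLp.tendstoInMeasure {μ : Measure Ω} {p : ENNReal} (hp : p ≠ 0) {f : ℕ → Ω → ℝ} {c : ℝ}
    (hf : TendstoLp μ p f c) : TendstoInMeasure μ f atTop fun _ => c :=
  tendstoInMeasure_of_tendsto_eLpNorm hp (fun N => (hf.1 N).1) aestronglyMeasurable_const hf.2

variable {ξ : ℕ → Ω → ℝ} {σ H B : ℝ} {τ ℓ : ℕ → ℝ}

theorem sum_sum_shift_sq_le (hB : ∀ n, |gcoef σ H (n + 1)| ≤ B) (N : ℕ) :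
    ∑ i ∈ Finset.range N, ∑ l ∈ Finset.range N,
      (if l = i + 1 then gcoef σ H (i + 1) * gcoef σ H (l + 1) else 0) ^ 2 ≤ B ^ 4 * N := by
  have hB0 : 0 ≤ B := (abs_nonneg _).trans (hB 0)
  have h1 : ∀ i ∈ Finset.range N, ∑ l ∈ Finset.range N,
      (if l = i + 1 then gcoef σ H (i + 1) * gcoef σ H (l + 1) else 0) ^ 2 ≤ B ^ 4 := by
    intro i _
    simp only [ite_pow, ne_eq, OfNat.ofNat_ne_zero, not_false_eq_true, zero_pow,
      Finset.sum_ite_eq', Finset.mem_range]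
    split_ifs
    · rw [mul_pow, ← sq_abs, ← sq_abs (gcoef σ H (i + 1 + 1))]
      calc _ ≤ B ^ 2 * B ^ 2 := by gcongr <;> exact hB _
        _ = B ^ 4 := by ring
    · positivity
  refine (Finset.sum_le_sum h1).trans (le_of_eq ?_)
  rw [Finset.sum_const, Finset.card_range, nsmul_eq_mul, mul_comm]

/-- The `L²` form serves the convergence of the total value; the matrix lives just above the
diagonal and has trace zero. -/
theorem tendstoLp_S1 (he : IsRademacher (fun i => ξ (i + 1)) P)
    (hB : ∀ n, |gcoef σ H (n + 1)| ≤ B) :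
    TendstoLp P 2 (fun N ω => 1 / (N : ℝ) * S1 σ H ξ N ω) 0 := by
  simp only [S1_eq_quadForm]
  refine he.tendstoLp_quadForm
    (fun _ i l => if l = i + 1 then gcoef σ H (i + 1) * gcoef σ H (l + 1) else 0) 0 ?_ ?_
  · simp
  · exact tendsto_one_div_sq_mul_of_le (fun N => by positivity) (sum_sum_shift_sq_le hB)

theorem ae_tendsto_S1 (he : IsRademacher (fun i => ξ (i + 1)) P)
    (hB : ∀ n, |gcoef σ H (n + 1)| ≤ B) :
    ∀ᵐ ω ∂P, Tendsto (fun N : ℕ => 1 / (N : ℝ) * S1 σ H ξ N ω) atTop (𝓝 0) := by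
  have hB0 : 0 ≤ B := (abs_nonneg _).trans (hB 0)
  refine ae_tendsto_div_of_integral_sq_le (C := B ^ 2) (D := 2 * B ^ 4) (fun n => ?_)
    (fun ω => by simp [S1]) ?_ fun N => ?_
  · rw [show S1 σ H ξ n = _ from funext (S1_eq_quadForm σ H ξ n)]
    exact he.measurable_quadForm n
      (fun i l => if l = i + 1 then gcoef σ H (i + 1) * gcoef σ H (l + 1) else 0)
  · filter_upwards [he.ae_all] with ω hω n
    simp only [S1, sum_Icc_one_eq, Finset.sum_range_succ, add_sub_cancel_left, Nat.add_sub_cancel]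
    rcases n with _ | n
    · simp only [gcoef_zero, zero_mul, abs_zero]
      positivity
    · simp only [abs_mul, hω, mul_one, sq]
      exact mul_le_mul (hB n) (hB (n + 1)) (abs_nonneg _) hB0
  · have h := he.integral_sq_quadForm_le N
      (fun i l => if l = i + 1 then gcoef σ H (i + 1) * gcoef σ H (l + 1) else 0)
    simp only [S1_eq_quadForm]
    have h0 : ∑ i ∈ Finset.range N,
        (if i = i + 1 then gcoef σ H (i + 1) * gcoef σ H (i + 1) else 0) = 0 := by simp
    rw [h0] at h
    simp only [sub_zero] at h
    linarith [sum_sum_shift_sq_le hB N]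

theorem tendstoLp_S2 (he : IsRademacher (fun i => ξ (i + 1)) P)
    (hB : ∀ n, |gcoef σ H (n + 1)| ≤ B) (hc : IsTailArray (jArr σ H) τ ℓ) :
    TendstoLp P 2 (fun N ω => 1 / (N : ℝ) * S2 σ H ξ N ω) 0 := by
  simp only [S2_eq_quadForm]
  refine he.tendstoLp_quadForm (fun _ i l => gcoef σ H (i + 1) * jArr σ H i l) 0 ?_ ?_
  · simp [jArr_of_le]
  · refine tendsto_one_div_sq_mul_of_le (C := B ^ 2 * τ 0) (fun N => by positivity) fun N => ?_
    have h1 : ∀ i ∈ Finset.range N, ∑ l ∈ Finset.range N,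
        (gcoef σ H (i + 1) * jArr σ H i l) ^ 2 ≤ B ^ 2 * τ 0 := by
      intro i _
      simp_rw [mul_pow]
      rw [← Finset.mul_sum, ← sq_abs]
      exact mul_le_mul (pow_le_pow_left₀ (abs_nonneg _) (hB i) 2) (hc.sum_range_sq_le N i)
        (Finset.sum_nonneg fun _ _ => sq_nonneg _) (sq_nonneg _)
    refine (Finset.sum_le_sum h1).trans (le_of_eq ?_)
    rw [Finset.sum_const, Finset.card_range, nsmul_eq_mul, mul_comm]

theorem tendstoLp_S3 (he : IsRademacher (fun i => ξ (i + 1)) P)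
    (hB : ∀ n, |gcoef σ H (n + 1)| ≤ B) {g : ℝ}
    (hg : Tendsto (fun n => gcoef σ H (n + 1)) atTop (𝓝 g))
    (hc : IsTailArray (jArr σ H) τ ℓ) :
    TendstoLp P 2 (fun N ω => 1 / (N : ℝ) * S3 σ H ξ N ω) (g * ℓ 0) := by
  simp only [S3_eq_quadForm]
  refine he.tendstoLp_quadForm
    (fun N i l => if i + 1 < N then gcoef σ H (i + 1) * jArr σ H (i + 2) l else 0) _ ?_ ?_
  · have hu : Tendsto (fun n => gcoef σ H (n + 1) * jArr σ H (n + 2) n) atTop (𝓝 (g * ℓ 0)) :=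
      hg.mul (hc.tendsto_diag 0)
    have h1 := hu.cesaro
    have h2 := (tendsto_one_div_atTop_nhds_zero_nat (𝕜 := ℝ)).comp (tendsto_add_atTop_nat 1)
    -- At size `n + 1` the trace has only `n` terms because of the cutoff, so the last term of the
    -- Cesàro mean is subtracted; it is negligible after normalisation.
    have h3 := ((tendsto_add_atTop_iff_nat 1).2 h1).sub (h2.mul hu)
    rw [zero_mul, sub_zero] at h3
    rw [← tendsto_add_atTop_iff_nat 1]
    refine h3.congr fun n => ?_
    simp only [Function.comp_apply]
    rw [Finset.sum_range_succ, Finset.sum_range_succ, if_neg (by omega), add_zero]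
    have h4 : ∑ i ∈ Finset.range n,
        (if i + 1 < n + 1 then gcoef σ H (i + 1) * jArr σ H (i + 2) i else 0) =
        ∑ i ∈ Finset.range n, gcoef σ H (i + 1) * jArr σ H (i + 2) i :=
      Finset.sum_congr rfl fun i hi => if_pos (by have := Finset.mem_range.1 hi; omega)
    rw [h4]
    ring
  · refine tendsto_one_div_sq_mul_of_le (C := B ^ 2 * τ 0) (fun N => by positivity) fun N => ?_
    have h1 : ∀ i ∈ Finset.range N, ∑ l ∈ Finset.range N,
        (if i + 1 < N then gcoef σ H (i + 1) * jArr σ H (i + 2) l else 0) ^ 2 ≤ B ^ 2 * τ 0 := by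
      intro i _
      have h0 := hc.tail_nonneg 0
      split_ifs
      · simp_rw [mul_pow]
        rw [← Finset.mul_sum, ← sq_abs]
        exact mul_le_mul (pow_le_pow_left₀ (abs_nonneg _) (hB i) 2)
          (hc.sum_range_sq_le N (i + 2))
          (Finset.sum_nonneg fun _ _ => sq_nonneg _) (sq_nonneg _)
      · simp only [ne_eq, OfNat.ofNat_ne_zero, not_false_eq_true, zero_pow, Finset.sum_const_zero]
        positivity
    refine (Finset.sum_le_sum h1).trans (le_of_eq ?_)
    rw [Finset.sum_const, Finset.card_range, nsmul_eq_mul, mul_comm]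

theorem tendstoLp_S4 (he : IsRademacher (fun i => ξ (i + 1)) P)
    (hc : IsTailArray (jArr σ H) τ ℓ) :
    TendstoLp P 2 (fun N ω => 1 / (N : ℝ) * S4 σ H ξ N ω) (∑' m, ℓ m * ℓ (m + 1)) := by
  simp only [S4_eq_quadForm]
  refine he.tendstoLp_quadForm
    (fun N i l => ∑ p ∈ Finset.range N, jArr σ H p i * jArr σ H (p + 1) l) _ ?_
    hc.tendsto_hilbertSchmidt
  -- After exchanging the sums, the trace divided by `N` is the Cesàro mean of the covariances of
  -- consecutive rows.
  refine hc.tendsto_sum_mul.cesaro.congr fun N => ?_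
  rw [one_div, Finset.sum_comm]
  congr 1
  refine Finset.sum_congr rfl fun p hp => ?_
  refine Finset.sum_subset (Finset.range_subset_range.2 (Finset.mem_range.1 hp).le) fun i _ hi => ?_
  rw [Finset.mem_range] at hi
  rw [jArr_of_le (by omega), zero_mul]

/-- Cauchy-Schwarz bounds `|X_n|` by a multiple of `√N` plus `B` for all `n ≤ N`, and `N ^ H`
eventually exceeds this since `H > 1/2`; so no factor `1 + X_n / N ^ H` can vanish. -/
theorem eventually_stock_ne_zero {s₀ : ℝ} (hs₀ : s₀ ≠ 0) (hH : 1 / 2 < H)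
    (he : IsRademacher (fun i => ξ (i + 1)) P)
    (hB : ∀ n, |gcoef σ H (n + 1)| ≤ B) (hc : IsTailArray (jArr σ H) τ ℓ) :
    ∀ᶠ N : ℕ in atTop, ∀ᵐ ω ∂P, ∀ n ≤ N, stock σ H s₀ ξ N n ω ≠ 0 := by
  have hB0 : 0 ≤ B := (abs_nonneg _).trans (hB 0)
  have hlim : Tendsto (fun N : ℕ => (N : ℝ) ^ (-(H - 1 / 2)) * (Real.sqrt (τ 0) + B)) atTop
      (𝓝 0) := by
    have := ((tendsto_rpow_neg_atTop (show 0 < H - 1 / 2 by linarith)).comp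
      tendsto_natCast_atTop_atTop).mul_const (Real.sqrt (τ 0) + B)
    simpa using this
  filter_upwards [hlim.eventually_lt_const one_pos, eventually_ge_atTop 1] with N hN hN1
  have hN1' : (1 : ℝ) ≤ N := by exact_mod_cast hN1
  have hN0 : (0 : ℝ) < N := by linarith
  have hbound : Real.sqrt N * Real.sqrt (τ 0) + B < (N : ℝ) ^ H := by
    have h1 : 1 ≤ Real.sqrt N := Real.one_le_sqrt.2 hN1'
    have h2 : (N : ℝ) ^ H * (N : ℝ) ^ (-(H - 1 / 2)) = Real.sqrt N := by
      rw [← Real.rpow_add hN0, Real.sqrt_eq_rpow]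
      ring_nf
    have h3 := mul_lt_mul_of_pos_left hN (Real.rpow_pos_of_pos hN0 H)
    rw [← mul_assoc, h2, mul_one] at h3
    nlinarith
  filter_upwards [he.ae_all] with ω hω
  refine stock_ne_zero hs₀ fun n hn => lt_of_le_of_lt ?_ hbound
  rw [X, Y_eq_sum_range (N := n) σ H ξ (by omega)]
  refine (abs_add_le _ _).trans (add_le_add ?_ ?_)
  · calc |∑ i ∈ Finset.range n, jArr σ H n i * ξ (i + 1) ω|
        ≤ ∑ i ∈ Finset.range n, |jArr σ H n i| := by
          refine (Finset.abs_sum_le_sum_abs _ _).trans (le_of_eq ?_)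
          simp only [abs_mul, hω, mul_one]
      _ ≤ Real.sqrt (n * τ 0) := Real.le_sqrt_of_sq_le (hc.sq_sum_abs_le n)
      _ ≤ Real.sqrt (N * τ 0) := by
          refine Real.sqrt_le_sqrt (mul_le_mul_of_nonneg_right ?_ (hc.tail_nonneg 0))
          exact_mod_cast hn
      _ = _ := Real.sqrt_mul hN0.le _
  · rcases n with _ | n
    · simpa [gcoef_zero] using hB0
    · rw [abs_mul, hω, mul_one]
      exact hB n

end Convergence

theorem isTailArray_jArr {σ H : ℝ} (hσ : 0 < σ) (hH : 1 / 2 < H) (hH1 : H < 1) :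
    ∃ τ : ℕ → ℝ, IsTailArray (jArr σ H) τ fun m => 2 * gconst σ H * rho H (m + 1) := by
  obtain ⟨τ, hτ, hτ'⟩ := exists_tail_bound hσ hH hH1
  exact ⟨τ, fun _ _ => jArr_of_le, hτ, hτ', tendsto_jArr hσ hH hH1⟩

theorem rho_one (H : ℝ) (hH : 1 / 2 < H) : rho H 1 = 1 / 2 * ((2 : ℝ) ^ (H + 1 / 2) - 2) := by
  rw [rho_eq, show H - 1 / 2 + 1 = H + 1 / 2 by ring]
  norm_num
  rw [Real.zero_rpow (by linarith)]

end FracBinary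

end

theorem mainTheorem3 {Ω : Type*} [MeasurableSpace Ω] (P : Measure Ω) [IsProbabilityMeasure P]
    (σ H s₀ : ℝ) (hσ : 0 < σ) (hH : 1 / 2 < H) (hH1 : H < 1) (hs₀ : 0 < s₀)
    (ξ : ℕ → Ω → ℝ)
    (hmeas : ∀ i, 1 ≤ i → Measurable (ξ i))
    (hindep : iIndepFun (fun i : ℕ => ξ (i + 1)) P)
    (hplus : ∀ i, 1 ≤ i → P {ω | ξ i ω = 1} = 1 / 2)
    (hminus : ∀ i, 1 ≤ i → P {ω | ξ i ω = -1} = 1 / 2) :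
    -- for large `N` the prices almost surely do not vanish, so that `φ^N` is well defined
    (∀ᶠ N : ℕ in atTop, ∀ᵐ ω ∂P, ∀ n ≤ N, FracBinary.stock σ H s₀ ξ N n ω ≠ 0) ∧
    -- the value process and its splitting
    (∀ N : ℕ, 1 ≤ N → ∀ ω, (∀ n ≤ N, FracBinary.stock σ H s₀ ξ N n ω ≠ 0) → ∀ n ≤ N,
      FracBinary.V σ H s₀ ξ N n ω =
          1 / (N : ℝ) * ∑ k ∈ Finset.Icc 1 n,
            FracBinary.X σ H ξ (k - 1) ω * FracBinary.X σ H ξ k ω ∧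
      FracBinary.V σ H s₀ ξ N n ω =
          1 / (N : ℝ) * (FracBinary.S1 σ H ξ n ω + FracBinary.S2 σ H ξ n ω
            + FracBinary.S3 σ H ξ n ω + FracBinary.S4 σ H ξ n ω)) ∧
    -- (1)
    (∀ᵐ ω ∂P, Tendsto (fun N : ℕ => 1 / (N : ℝ) * FracBinary.S1 σ H ξ N ω) atTop (𝓝 0)) ∧
    -- (2)
    FracBinary.TendstoLp P 2 (fun N ω => 1 / (N : ℝ) * FracBinary.S2 σ H ξ N ω) 0 ∧
    -- (3)
    FracBinary.TendstoLp P 2 (fun N ω => 1 / (N : ℝ) * FracBinary.S3 σ H ξ N ω)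
      (FracBinary.gconst σ H ^ 2 * ((2 : ℝ) ^ (H + 1 / 2) - 2)) ∧
    0 < FracBinary.gconst σ H ^ 2 * ((2 : ℝ) ^ (H + 1 / 2) - 2) ∧
    -- (4)
    Summable (fun k : ℕ => FracBinary.rho H (k + 2) * FracBinary.rho H (k + 1)) ∧
    FracBinary.TendstoLp P 1 (fun N ω => 1 / (N : ℝ) * FracBinary.S4 σ H ξ N ω)
      (4 * FracBinary.gconst σ H ^ 2 * FracBinary.rhoSeries H) ∧
    0 < 4 * FracBinary.gconst σ H ^ 2 * FracBinary.rhoSeries H ∧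
    -- convergence of the value at maturity
    TendstoInMeasure P (fun (N : ℕ) ω => FracBinary.V σ H s₀ ξ N N ω) atTop
      (fun _ => FracBinary.vartheta σ H) ∧
    0 < FracBinary.vartheta σ H := by
  open FracBinary in
  -- The shift leaves out `ξ 0`, which occurs only multiplied by `g_0 = 0`.
  have he : IsRademacher (fun i => ξ (i + 1)) P :=
    ⟨fun i => hmeas _ (by omega), hindep, fun i => hplus _ (by omega),
      fun i => hminus _ (by omega)⟩
  obtain ⟨τ, hc⟩ := isTailArray_jArr hσ hH hH1
  have hg := tendsto_gcoef hσ hH hH1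
  have hgpos := gconst_pos hσ hH hH1
  obtain ⟨B, hB'⟩ := hg.abs.bddAbove_range
  have hB : ∀ n, |gcoef σ H (n + 1)| ≤ B := fun n => hB' ⟨n, rfl⟩
  have hlim3 : gconst σ H * (2 * gconst σ H * rho H (0 + 1)) =
      gconst σ H ^ 2 * ((2 : ℝ) ^ (H + 1 / 2) - 2) := by
    rw [zero_add, rho_one H hH]
    ring
  have hpos3 : 0 < gconst σ H ^ 2 * ((2 : ℝ) ^ (H + 1 / 2) - 2) := by
    have := rho_pos hH (m := 0 + 1) le_rfl
    rw [← hlim3]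
    positivity
  have hfun : (fun m => 2 * gconst σ H * rho H (m + 1) * (2 * gconst σ H * rho H (m + 1 + 1))) =
      fun m => 4 * gconst σ H ^ 2 * (rho H (m + 2) * rho H (m + 1)) := by
    ext m
    ring
  have hsum : Summable fun k : ℕ => rho H (k + 2) * rho H (k + 1) := by
    have h := hc.summable_mul
    rw [hfun] at h
    exact (summable_mul_left_iff (by positivity)).1 h
  have hlim4 : ∑' m, 2 * gconst σ H * rho H (m + 1) * (2 * gconst σ H * rho H (m + 1 + 1)) =
      4 * gconst σ H ^ 2 * rhoSeries H := by
    rw [hfun, tsum_mul_left, rhoSeries]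
  have hpos4 : 0 < 4 * gconst σ H ^ 2 * rhoSeries H := by
    have : 0 < rhoSeries H :=
      hsum.tsum_pos (fun k => (mul_pos (rho_pos hH (by omega)) (rho_pos hH (by omega))).le) 0
        (mul_pos (rho_pos hH (by omega)) (rho_pos hH (by omega)))
    positivity
  have hstock := eventually_stock_ne_zero hs₀.ne' hH he hB hc
  have h1 := tendstoLp_S1 he hB
  have h2 := tendstoLp_S2 he hB hc
  have h3 := tendstoLp_S3 he hB hg hc
  have h4 := tendstoLp_S4 he hc
  rw [hlim3] at h3
  rw [hlim4] at h4
  refine ⟨hstock, fun N hN ω hω n hn => ⟨V_eq σ H s₀ ξ hN hω hn, ?_⟩, ae_tendsto_S1 he hB, h2, h3,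
    hpos3, hsum, h4.mono_exponent (by norm_num), hpos4, ?_, add_pos hpos4 hpos3⟩
  · rw [V_eq σ H s₀ ξ hN hω hn, sum_X_mul_X]
  · have hadd := ((((h1.add (by norm_num) h2).add (by norm_num) h3).add (by norm_num)
      h4).tendstoInMeasure (by norm_num))
    have hconst : 0 + 0 + gconst σ H ^ 2 * ((2 : ℝ) ^ (H + 1 / 2) - 2) +
        4 * gconst σ H ^ 2 * rhoSeries H = vartheta σ H := by
      rw [vartheta]
      ring
    rw [hconst] at hadd
    -- The value agrees with the normalised sum only for large `N` and off a null set, which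
    -- suffices for convergence in measure.
    refine hadd.congr' ?_ EventuallyEq.rfl
    filter_upwards [hstock, eventually_ge_atTop 1] with N hN hN1
    filter_upwards [hN] with ω hω
    rw [V_eq σ H s₀ ξ hN1 hω le_rfl, sum_X_mul_X]
    ring
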